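/- Let $r$ and $s$ be multiplicatively independent positive integers, that is, $\log r/\log s$ is irrational (in particular $r,s\ge 2$). Let $X,Y\subseteq[0,1]$ be non-empty closed sets with $T_rX\subseteq X$ and $T_sY\subseteq Y$, where $T_q x=\{qx\}$ denotes the fractional part of $qx$. Put $\overline\gamma=\min(\dim_{\mathrm H}X+\dim_{\mathrm H}Y,\,1)$, where $\dim_{\mathrm H}$ is the Hausdorff dimension. For $\theta\in\mathbb R$ let $\pi_\theta:\mathbb R^2\to\mathbb R^2$ be the orthogonal projection onto the line through the origin that forms the angle $\theta$ with the positive $x$-axis. For $\gamma\ge 0$ and $S\subseteq\mathbb R^2$ let \[ \mathcal H^\gamma_\infty(S)=\inf\Big\{\sum_{i}\delta_i^\gamma \;:\; S\subseteq\bigcup_{i}B_i,\ B_i\text{ an open ball of diameter }\delta_i>0\Big\} \] be the unlimited $\gamma$-Hausdorff content, the infimum being over all countable (finite or infinite) covers. Then for every compact $I\subseteq(0,\pi)\setminus\{\pi/2\}$ and every $\gamma$ with $0\le\gamma<\overline\gamma$, \[ \inf_{\theta\in I}\ \mathcal H^\gamma_\infty\big(\pi_\theta(X\times Y)\big)>0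 . \] -/

import Mathlib

open Set Metric
open scoped ENNReal

noncomputable section

/-- Two positive integers are multiplicatively independent if `log r / log s` is irrational.
(If `r = 1` or `s = 1` the quotient is `0` in Lean, so the condition fails.) -/
def MultIndep (r s : ℕ) : Prop :=
  0 < r ∧ 0 < s ∧ Irrational (Real.log r / Real.log s)

/-- The map `x ↦ r x (mod 1)`, with values in `[0, 1)`. -/
def timesMap (r : ℕ) (x : ℝ) : ℝ := Int.fract ((r : ℝ) * x)

/-- `X` is a `× r`-invariant subset of `[0, 1]`: a closed subset `X` of `[0, 1]` with
`T_r X ⊆ X`. -/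
structure IsTimesInvariant (r : ℕ) (X : Set ℝ) : Prop where
  subset_unitInterval : X ⊆ Icc 0 1
  isClosed : IsClosed X
  image_subset : timesMap r '' X ⊆ X

/-- The unlimited `γ`-Hausdorff content of a subset `S` of `ℝ^d`: the infimum of
`∑ i, (δ i) ^ γ` over all countable (finite or infinite) covers of `S` by open balls of
diameters `δ i > 0`. There is no upper bound on the diameters. -/
def hausdorffContent {d : ℕ} (γ : ℝ) (S : Set (EuclideanSpace ℝ (Fin d))) : ℝ≥0∞ :=
  sInf {t : ℝ≥0∞ | ∃ (ι : Type) (_ : Countable ι)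
      (c : ι → EuclideanSpace ℝ (Fin d)) (δ : ι → ℝ),
      (∀ i, 0 < δ i) ∧ S ⊆ ⋃ i, ball (c i) (δ i / 2) ∧
      t = ∑' i, ENNReal.ofReal (δ i ^ γ)}

/-- The line in the Euclidean plane through the origin that forms the angle `θ` with the positive
`x`-axis. -/
def angleLine (θ : ℝ) : Submodule ℝ (EuclideanSpace ℝ (Fin 2)) :=
  Submodule.span ℝ {!₂[Real.cos θ, Real.sin θ]}

instance angleLine_hasOrthogonalProjection (θ : ℝ) : (angleLine θ).HasOrthogonalProjection := by
  unfold angleLine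
  infer_instance

/-- The orthogonal projection `ℝ² → ℝ²` onto the line `angleLine θ`. -/
def angleProj (θ : ℝ) : EuclideanSpace ℝ (Fin 2) → EuclideanSpace ℝ (Fin 2) :=
  fun p => (angleLine θ).starProjection p

/-- The Cartesian product `X × Y` as a subset of the Euclidean plane. -/
def planeProd (X Y : Set ℝ) : Set (EuclideanSpace ℝ (Fin 2)) :=
  {p | p 0 ∈ X ∧ p 1 ∈ Y}

end

/-! With τ = tan θ, the set π_θ(X × Y) is X + τY up to the factor cos θ, so the claim is a lower
bound for covers of X + τY by intervals, uniform for |τ| in a compact subset of (0, ∞). The proof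
replaces measures by counting measures on finite sets and entropies by sums of logarithms of fibre
sizes.

Subadditivity of the number of digit cells gives exponents α ≥ dim X and β ≥ dim Y
(`IsFractInvariant.exists_exponent`). After passing to powers of r and s, a single digit step
already has almost the right branching. Choose one point of X and one of Y in each cell of a deep
level. Total entropy is then nearly as large as the branching allows, so at most levels there is
little room for concentration: the summed deficits are small (`IsFractInvariant.sum_deficit_le`). At
each level a discrete Marstrand argument, averaging over finitely many directions, bounds the
entropy of the projection below by almost min(α + β, 1) times the logarithm of the scale ratio,
minus these deficits (`sum_directions_entropy_ge`).

One direction t therefore has large total projection entropy over all levels. In that direction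
`exists_separated_subset` extracts a large subset of the product whose points have separated
projections at the level where they split (`exists_direction_separated`). A cell of this subset that
maximises a weighted cardinality is Frostman. Invariance of X and Y magnifies it to unit size, which
turns t into t r^p / s^q. Separation survives a perturbation of the direction by an amount κ
independent of the depth (`levelCell_eq_of_proj_close`, `exists_frostman_points`). A limit of
directions then gives one open interval of directions good at all depths
(`exists_frostman_direction`).

Finally, the numbers r^a / s^b are dense in (0, ∞) by independence, so every slope T > 0 is carried
into that interval by some r^a / s^b. A cover of X + σTY becomes r^a s^b translated covers of the
Frostman projection, which bounds its size below (`one_le_of_cover`). The bound is locally uniform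
in T, and compactness finishes (`exists_cover_sum_ge`). -/

/-! ### Entropy inequalities for counting measures on finite sets. -/

section Counting

variable {α ι : Type*} [DecidableEq ι]

/-- The points of `A` with the same value of `f` as `z`. -/
def fiberAt (A : Finset α) (f : α → ι) (z : α) : Finset α := A.filter fun w => f w = f z

theorem mem_fiberAt {A : Finset α} {f : α → ι} {z w : α} :
    w ∈ fiberAt A f z ↔ w ∈ A ∧ f w = f z := Finset.mem_filter

theorem self_mem_fiberAt {A : Finset α} {f : α → ι} {z : α} (hz : z ∈ A) :
    z ∈ fiberAt A f z := mem_fiberAt.2 ⟨hz, rfl⟩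

theorem card_fiberAt_pos {A : Finset α} {f : α → ι} {z : α} (hz : z ∈ A) :
    0 < ((fiberAt A f z).card : ℝ) :=
  Nat.cast_pos.2 (Finset.card_pos.2 ⟨z, self_mem_fiberAt hz⟩)

/-- The graph of log lies below its tangent at c. Summed over a finite set, this takes the place of
Jensen's inequality throughout. -/
theorem Real.log_le_log_add_div_sub_one {x c : ℝ} (hx : 0 < x) (hc : 0 < c) :
    Real.log x ≤ Real.log c + x / c - 1 := by
  have := Real.log_le_sub_one_of_pos (div_pos hx hc)
  rw [Real.log_div hx.ne' hc.ne'] at this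
  linarith

/-- The points of B in one fibre carry weight 1 / |fibre in A| each, hence at most 1 together. -/
theorem sum_inv_card_fiberAt_le {A B : Finset α} (f : α → ι) (h : B ⊆ A) :
    ∑ x ∈ B, ((fiberAt A f x).card : ℝ)⁻¹ ≤ (B.image f).card := by
  rw [← Finset.sum_fiberwise_of_maps_to (t := B.image f) (g := f)
    (fun x hx => Finset.mem_image_of_mem f hx)]
  rw [Finset.card_eq_sum_ones, Nat.cast_sum]
  refine Finset.sum_le_sum fun c hc => ?_
  obtain ⟨x, hx, rfl⟩ := Finset.mem_image.1 hc
  have h1 : ∀ y ∈ B.filter (fun y => f y = f x),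
      ((fiberAt A f y).card : ℝ)⁻¹ = ((fiberAt A f x).card : ℝ)⁻¹ := by
    intro y hy
    rw [fiberAt, fiberAt, (Finset.mem_filter.1 hy).2]
  rw [Finset.sum_congr rfl h1, Finset.sum_const, nsmul_eq_mul, Nat.cast_one,
    ← div_eq_mul_inv, div_le_one (card_fiberAt_pos (h hx))]
  exact_mod_cast Finset.card_le_card (Finset.filter_subset_filter _ h)

/-- Double counting: after exchanging the sums, each y receives the weights 1 / |fibre| of the x
related to it, at most 1 for each fibre met. -/
theorem sum_card_div_card_fiberAt_le (A : Finset α) (f : α → ι) (rel : α → α → Prop)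
    [∀ x, DecidablePred (rel x)] [∀ x, DecidablePred fun y => rel y x] (K : ℝ)
    (h : ∀ x ∈ A, (((A.filter fun y => rel y x).image f).card : ℝ) ≤ K) :
    ∑ x ∈ A, ((A.filter (rel x)).card : ℝ) / (fiberAt A f x).card ≤ K * A.card := by
  have h1 : ∀ x ∈ A, ((A.filter (rel x)).card : ℝ) / (fiberAt A f x).card
      = ∑ y ∈ A, if rel x y then ((fiberAt A f x).card : ℝ)⁻¹ else 0 := by
    intro x _
    rw [← Finset.sum_filter, Finset.sum_const, nsmul_eq_mul, div_eq_mul_inv]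
  rw [Finset.sum_congr rfl h1, Finset.sum_comm]
  have h2 : ∀ y ∈ A, (∑ x ∈ A, if rel x y then ((fiberAt A f x).card : ℝ)⁻¹ else 0) ≤ K := by
    intro y hy
    rw [← Finset.sum_filter]
    exact (sum_inv_card_fiberAt_le f (Finset.filter_subset _ _)).trans (h y hy)
  calc _ ≤ ∑ y ∈ A, K := Finset.sum_le_sum h2
    _ = K * A.card := by rw [Finset.sum_const, nsmul_eq_mul, mul_comm]

/-- Conditional entropy is at most the logarithm of the branching number. -/
theorem sum_log_fiberAt_ratio_le {κ : Type*} [DecidableEq κ] (A : Finset α) (f : α → κ)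
    (g : α → ι) {K : ℝ} (hK : 0 < K)
    (h : ∀ x ∈ A, (((fiberAt A f x).image g).card : ℝ) ≤ K) :
    ∑ x ∈ A, (Real.log (fiberAt A f x).card - Real.log (fiberAt A g x).card)
      ≤ A.card * Real.log K := by
  have h1 : ∑ x ∈ A, ((A.filter fun y => f y = f x).card : ℝ) / (fiberAt A g x).card
      ≤ K * A.card := by
    refine sum_card_div_card_fiberAt_le A g (fun x y => f y = f x) K fun x hx => ?_
    have := h x hx
    simp only [fiberAt] at this
    simpa only [eq_comm] using this
  calc _ ≤ ∑ x ∈ A, (Real.log K +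
        (((A.filter fun y => f y = f x).card : ℝ) / (fiberAt A g x).card) / K - 1) := by
        refine Finset.sum_le_sum fun x hx => ?_
        rw [← Real.log_div (card_fiberAt_pos hx).ne' (card_fiberAt_pos hx).ne']
        exact Real.log_le_log_add_div_sub_one
          (div_pos (card_fiberAt_pos hx) (card_fiberAt_pos hx)) hK
    _ = A.card * Real.log K +
        (∑ x ∈ A, ((A.filter fun y => f y = f x).card : ℝ) / (fiberAt A g x).card) / K
          - A.card := by
        rw [Finset.sum_sub_distrib, Finset.sum_add_distrib, Finset.sum_div]
        simp
    _ ≤ _ := by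
        have := div_le_of_le_mul₀ hK.le (Nat.cast_nonneg A.card) (h1.trans_eq (mul_comm _ _))
        linarith

/-- The points of `A` in the same `f`-cell as `x` whose `g`-cell equals or is adjacent to that
of `x`. -/
def nbrAt (A : Finset α) (f g : α → ℤ) (x : α) : Finset α :=
  A.filter fun y => f y = f x ∧ |g y - g x| ≤ 1

theorem card_nbrAt_pos {A : Finset α} {f g : α → ℤ} {x : α} (hx : x ∈ A) :
    0 < ((nbrAt A f g x).card : ℝ) :=
  Nat.cast_pos.2 (Finset.card_pos.2 ⟨x, Finset.mem_filter.2 ⟨hx, rfl, by simp⟩⟩)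

/-- The amount by which the information of the neighbourhood of `x` falls short of `c`. -/
noncomputable def deficit (A : Finset α) (f g : α → ℤ) (c : ℝ) (x : α) : ℝ :=
  max 0 (c - (Real.log (fiberAt A f x).card - Real.log (nbrAt A f g x).card))

/-- Were `deficit` defined without the truncation at 0 and with the exact cell of g, equality would
hold with c in place of c + 3. Allowing adjacent cells costs at most 3 - 1 on average, since three
values of g are adjacent; truncating costs at most 1 on average, since the mean of |f-fibre| /
|g-fibre| is at most exp c. -/
theorem sum_deficit_le (A : Finset α) (f g : α → ℤ)
    (hfg : ∀ x y, g x = g y → f x = f y) {c : ℝ}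
    (h : ∀ x ∈ A, (((fiberAt A f x).image g).card : ℝ) ≤ Real.exp c) :
    ∑ x ∈ A, deficit A f g c x ≤ A.card * (c + 3) -
      ∑ x ∈ A, (Real.log (fiberAt A f x).card - Real.log (fiberAt A g x).card) := by
  have h1 : ∑ x ∈ A, ((A.filter fun y => f y = f x).card : ℝ) / (fiberAt A g x).card
      ≤ Real.exp c * A.card := by
    refine sum_card_div_card_fiberAt_le A g (fun x y => f y = f x) _ fun x hx => ?_
    have := h x hx
    simp only [fiberAt] at this
    simpa only [eq_comm] using this
  have h2 : ∑ x ∈ A, ((A.filter fun y => f y = f x ∧ |g y - g x| ≤ 1).card : ℝ) /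
      (fiberAt A g x).card ≤ 3 * A.card := by
    refine sum_card_div_card_fiberAt_le A g (fun x y => f y = f x ∧ |g y - g x| ≤ 1) _
      fun x hx => ?_
    have : (A.filter fun y => f x = f y ∧ |g x - g y| ≤ 1).image g
        ⊆ Finset.Icc (g x - 1) (g x + 1) := by
      intro w hw
      obtain ⟨y, hy, rfl⟩ := Finset.mem_image.1 hw
      have := abs_le.1 (Finset.mem_filter.1 hy).2.2
      rw [Finset.mem_Icc]
      constructor <;> linarith
    have h3 := Finset.card_le_card this
    rw [Int.card_Icc] at h3
    have : (g x + 1 + 1 - (g x - 1)).toNat = 3 := by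
      rw [show g x + 1 + 1 - (g x - 1) = 3 by ring]; rfl
    rw [this] at h3
    exact_mod_cast h3
  have key : ∀ x ∈ A, deficit A f g c x ≤
      c - (Real.log (fiberAt A f x).card - Real.log (fiberAt A g x).card)
      + (((nbrAt A f g x).card : ℝ) / (fiberAt A g x).card - 1)
      + (((fiberAt A f x).card : ℝ) / (fiberAt A g x).card) / Real.exp c := by
    intro x hx
    have pF := card_fiberAt_pos (f := f) hx
    have pG := card_fiberAt_pos (f := g) hx
    have pN := card_nbrAt_pos (f := f) (g := g) hx
    have hGN : ((fiberAt A g x).card : ℝ) ≤ (nbrAt A f g x).card := by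
      refine Nat.cast_le.2 (Finset.card_le_card fun y hy => ?_)
      obtain ⟨hyA, hy⟩ := mem_fiberAt.1 hy
      exact Finset.mem_filter.2 ⟨hyA, hfg _ _ hy, by simp [hy]⟩
    have e1 : Real.log (nbrAt A f g x).card - Real.log (fiberAt A g x).card ≤
        ((nbrAt A f g x).card : ℝ) / (fiberAt A g x).card - 1 := by
      rw [← Real.log_div pN.ne' pG.ne']
      exact Real.log_le_sub_one_of_pos (div_pos pN pG)
    have e2 : Real.log (fiberAt A f x).card - Real.log (fiberAt A g x).card - c ≤
        (((fiberAt A f x).card : ℝ) / (fiberAt A g x).card) / Real.exp c - 1 := by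
      have := Real.log_le_sub_one_of_pos (div_pos (div_pos pF pG) (Real.exp_pos c))
      rwa [Real.log_div (div_pos pF pG).ne' (Real.exp_pos c).ne', Real.log_exp,
        Real.log_div pF.ne' pG.ne'] at this
    have e3 : 0 ≤ ((nbrAt A f g x).card : ℝ) / (fiberAt A g x).card - 1 := by
      rw [sub_nonneg, one_le_div pG]; exact hGN
    have e4 : 0 ≤ (((fiberAt A f x).card : ℝ) / (fiberAt A g x).card) / Real.exp c := by
      positivity
    exact max_le (by linarith) (by linarith)
  refine (Finset.sum_le_sum key).trans ?_
  rw [Finset.sum_add_distrib, Finset.sum_add_distrib, Finset.sum_sub_distrib,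
    Finset.sum_sub_distrib, Finset.sum_sub_distrib, ← Finset.sum_div]
  simp only [Finset.sum_const, nsmul_eq_mul, mul_one]
  have h3 : (∑ x ∈ A, ((fiberAt A f x).card : ℝ) / (fiberAt A g x).card) / Real.exp c
      ≤ A.card :=
    div_le_of_le_mul₀ (Real.exp_pos c).le (Nat.cast_nonneg A.card) (h1.trans_eq (mul_comm _ _))
  have h4 : ∑ x ∈ A, ((nbrAt A f g x).card : ℝ) / (fiberAt A g x).card ≤ 3 * A.card := h2
  linarith

end Counting

/-! ### Extraction of separated subsets and of Frostman cells. -/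

section Selection

variable {α ι : Type*} [DecidableEq ι]

theorem exists_residue_class_sum_ge {g : ℕ} (hg : 0 < g) (Λ : Finset ℤ) (b : ℤ → ℝ) :
    ∃ c : ℤ, ∑ i ∈ Λ, b i ≤ g * ∑ i ∈ Λ.filter (fun i => i % (g : ℤ) = c), b i := by
  have hg' : (0 : ℤ) < g := by exact_mod_cast hg
  have hne : (Finset.Ico (0 : ℤ) g).Nonempty := ⟨0, by simpa using hg⟩
  obtain ⟨c, -, hc⟩ := Finset.exists_max_image (Finset.Ico (0 : ℤ) g)
    (fun c => ∑ i ∈ Λ.filter (fun i => i % (g : ℤ) = c), b i) hne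
  refine ⟨c, ?_⟩
  rw [← Finset.sum_fiberwise_of_maps_to (s := Λ) (t := Finset.Ico (0 : ℤ) g)
    (g := fun i => i % (g : ℤ))
    (fun i _ => Finset.mem_Ico.2 ⟨Int.emod_nonneg _ hg'.ne', Int.emod_lt_of_pos _ hg'⟩)]
  refine (Finset.sum_le_card_nsmul _ _ _ hc).trans ?_
  simp

theorem le_abs_sub_of_emod_eq {g : ℕ} {a b c : ℤ} (ha : a % (g : ℤ) = c) (hb : b % (g : ℤ) = c)
    (hab : a ≠ b) : (g : ℤ) ≤ |a - b| := by
  have h : (g : ℤ) ∣ a - b := Int.ModEq.dvd (show b % (g : ℤ) = a % (g : ℤ) by rw [ha, hb])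
  exact Int.le_of_dvd (abs_pos.2 (sub_ne_zero.2 hab)) ((dvd_abs _ _).2 h)

/-- In a finite set with nested partitions `cell k` and integer labels `lab k` of the cells of
level `k + 1`, there is a subset whose points, when they split at level `k + 1`, have labels that
are at least `g` apart, and whose cardinality is controlled from below by the entropies of the
labels. -/
theorem exists_separated_subset [DecidableEq α] {g : ℕ} (hg : 0 < g)
    (cell : ℕ → α → ι) (lab : ℕ → α → ℤ)
    (hnest : ∀ k z w, cell (k + 1) z = cell (k + 1) w → cell k z = cell k w)
    (hlab : ∀ k z w, cell (k + 1) z = cell (k + 1) w → lab k z = lab k w) (n : ℕ) :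
    ∀ (k₀ : ℕ) (A : Finset α), A.Nonempty →
      (∀ z ∈ A, ∀ w ∈ A, cell k₀ z = cell k₀ w) →
      ∃ S ⊆ A, S.Nonempty ∧
        (∀ z ∈ S, ∀ w ∈ S, ∀ k, k₀ ≤ k → k < k₀ + n → cell k z = cell k w →
          cell (k + 1) z ≠ cell (k + 1) w → (g : ℤ) ≤ |lab k z - lab k w|) ∧
        ∑ z ∈ A, ∑ i ∈ Finset.range n, (Real.log (fiberAt A (cell (k₀ + i)) z).card -
            Real.log (fiberAt A (fun w => (cell (k₀ + i) w, lab (k₀ + i) w)) z).card)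
          ≤ A.card * (Real.log S.card + n * Real.log g) := by
  induction n with
  | zero =>
    rintro k₀ A ⟨z, hz⟩ -
    refine ⟨{z}, by simpa using hz, by simp, ?_, by simp⟩
    intro _ _ _ _ k h1 h2
    omega
  | succ n ih =>
    intro k₀ A hA hroot
    have : Nonempty α := ⟨hA.choose⟩
    have hcell : ∀ z ∈ A, ∃ S ⊆ fiberAt A (cell (k₀ + 1)) z, S.Nonempty ∧
        (∀ z ∈ S, ∀ w ∈ S, ∀ k, k₀ + 1 ≤ k → k < k₀ + 1 + n → cell k z = cell k w →
          cell (k + 1) z ≠ cell (k + 1) w → (g : ℤ) ≤ |lab k z - lab k w|) ∧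
        ∑ w ∈ fiberAt A (cell (k₀ + 1)) z, ∑ i ∈ Finset.range n,
            (Real.log (fiberAt A (cell (k₀ + 1 + i)) w).card -
            Real.log (fiberAt A
              (fun w => (cell (k₀ + 1 + i) w, lab (k₀ + 1 + i) w)) w).card)
          ≤ (fiberAt A (cell (k₀ + 1)) z).card * (Real.log S.card + n * Real.log g) := by
      intro z hz
      obtain ⟨S, h1, h2, h3, h4⟩ := ih (k₀ + 1) (fiberAt A (cell (k₀ + 1)) z)
        ⟨z, self_mem_fiberAt hz⟩ (fun a ha b hb => by
          rw [(mem_fiberAt.1 ha).2, (mem_fiberAt.1 hb).2])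
      refine ⟨S, h1, h2, h3, le_trans (le_of_eq ?_) h4⟩
      have hdeep : ∀ i a b, cell (k₀ + 1 + i) a = cell (k₀ + 1 + i) b →
          cell (k₀ + 1) a = cell (k₀ + 1) b := by
        intro i a b
        induction i with
        | zero => exact id
        | succ i ihi => exact fun h => ihi (hnest _ _ _ h)
      refine Finset.sum_congr rfl fun w hw => Finset.sum_congr rfl fun i _ => ?_
      have hwz := (mem_fiberAt.1 hw).2
      congr 4
      · ext v
        simp only [mem_fiberAt]
        exact ⟨fun h => ⟨⟨h.1, (hdeep i _ _ h.2).trans hwz⟩, h.2⟩, fun h => ⟨h.1.1, h.2⟩⟩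
      · ext v
        simp only [mem_fiberAt, Prod.mk.injEq]
        exact ⟨fun h => ⟨⟨h.1, (hdeep i _ _ h.2.1).trans hwz⟩, h.2⟩,
          fun h => ⟨h.1.1, h.2⟩⟩
    -- The subset for the whole cell will be a union of the inductively chosen subsets T of child
    -- cells: one child for each label, the one with largest T, and only labels in a single residue
    -- class mod g.
    choose! T hTsub hTne hTsep hTsum using hcell
    -- a representative of each cell, so that the selected subset depends only on the cell
    have hrep : ∀ z ∈ A, ∃ w ∈ (A : Set α), cell (k₀ + 1) w = cell (k₀ + 1) z :=
      fun z hz => ⟨z, hz, rfl⟩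
    set rep : α → α := fun z =>
      Function.invFunOn (cell (k₀ + 1)) (A : Set α) (cell (k₀ + 1) z) with hrepdef
    have rep_mem : ∀ z ∈ A, rep z ∈ A := fun z hz => Function.invFunOn_mem (hrep z hz)
    have rep_cell : ∀ z ∈ A, cell (k₀ + 1) (rep z) = cell (k₀ + 1) z :=
      fun z hz => Function.invFunOn_eq (hrep z hz)
    have rep_congr : ∀ z w, cell (k₀ + 1) z = cell (k₀ + 1) w → rep z = rep w :=
      fun z w h => by simp only [hrepdef, h]
    -- the tail of the entropy sum
    have htail : ∑ z ∈ A, ∑ i ∈ Finset.range n,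
        (Real.log (fiberAt A (cell (k₀ + 1 + i)) z).card -
            Real.log (fiberAt A
              (fun w => (cell (k₀ + 1 + i) w, lab (k₀ + 1 + i) w)) z).card)
        ≤ ∑ z ∈ A, (Real.log (T (rep z)).card + n * Real.log g) := by
      rw [← Finset.sum_fiberwise_of_maps_to (s := A) (t := A.image (cell (k₀ + 1)))
        (g := cell (k₀ + 1)) (fun i hi => Finset.mem_image_of_mem _ hi),
        ← Finset.sum_fiberwise_of_maps_to (s := A) (t := A.image (cell (k₀ + 1)))
        (g := cell (k₀ + 1)) (fun i hi => Finset.mem_image_of_mem _ hi)]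
      refine Finset.sum_le_sum fun c hc => ?_
      obtain ⟨z, hz, rfl⟩ := Finset.mem_image.1 hc
      have h1 := hTsum (rep z) (rep_mem z hz)
      have h2 : fiberAt A (cell (k₀ + 1)) (rep z) =
          A.filter fun w => cell (k₀ + 1) w = cell (k₀ + 1) z := by
        rw [fiberAt, rep_cell z hz]
      rw [h2] at h1
      refine h1.trans (le_of_eq ?_)
      rw [← nsmul_eq_mul, ← Finset.sum_const]
      refine Finset.sum_congr rfl fun w hw => ?_
      rw [rep_congr w z (Finset.mem_filter.1 hw).2]
    -- the best cell for each label
    have hbest : ∀ i ∈ A.image (lab k₀), ∃ z ∈ A, lab k₀ z = i ∧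
        ∀ w ∈ A, lab k₀ w = i → (T (rep w)).card ≤ (T (rep z)).card := by
      intro i hi
      obtain ⟨z₀, hz₀, h0⟩ := Finset.mem_image.1 hi
      obtain ⟨z, hz, hmax⟩ := Finset.exists_max_image (A.filter fun w => lab k₀ w = i)
        (fun w => (T (rep w)).card) ⟨z₀, Finset.mem_filter.2 ⟨hz₀, h0⟩⟩
      obtain ⟨h1, h2⟩ := Finset.mem_filter.1 hz
      exact ⟨z, h1, h2, fun w hw hwi => hmax w (Finset.mem_filter.2 ⟨hw, hwi⟩)⟩
    choose! top htopA htopi htopmax using hbest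
    set Λ := A.image (lab k₀) with hΛ
    set b : ℤ → ℝ := fun i => ((T (rep (top i))).card : ℝ) with hb
    have hbpos : ∀ i ∈ Λ, 0 < b i := fun i hi =>
      Nat.cast_pos.2 (Finset.card_pos.2 (hTne _ (rep_mem _ (htopA i hi))))
    have hΛne : Λ.Nonempty := hA.image _
    set B := ∑ i ∈ Λ, b i with hB
    have hBpos : 0 < B := Finset.sum_pos hbpos hΛne
    have hcA : (0 : ℝ) < A.card := Nat.cast_pos.2 (Finset.card_pos.2 hA)
    -- the Gibbs inequality
    have hgibbs : ∑ z ∈ A, (Real.log A.card - Real.log (fiberAt A (lab k₀) z).card +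
        Real.log (b (lab k₀ z))) ≤ A.card * Real.log B := by
      have hpt : ∀ z ∈ A, Real.log A.card - Real.log (fiberAt A (lab k₀) z).card +
          Real.log (b (lab k₀ z)) ≤ Real.log B - 1 + (A.card / B) *
            (b (lab k₀ z) * ((fiberAt A (lab k₀) z).card : ℝ)⁻¹) := by
        intro z hz
        have p1 := card_fiberAt_pos (f := lab k₀) hz
        have p2 := hbpos _ (Finset.mem_image_of_mem (lab k₀) hz)
        rw [← Real.log_div hcA.ne' p1.ne', ← Real.log_mul (div_pos hcA p1).ne' p2.ne']
        refine (Real.log_le_log_add_div_sub_one (mul_pos (div_pos hcA p1) p2) hBpos).trans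
          (le_of_eq ?_)
        field_simp
        ring
      refine (Finset.sum_le_sum hpt).trans ?_
      rw [Finset.sum_add_distrib, ← Finset.mul_sum]
      have : ∑ z ∈ A, b (lab k₀ z) * ((fiberAt A (lab k₀) z).card : ℝ)⁻¹ ≤ B := by
        rw [← Finset.sum_fiberwise_of_maps_to (s := A) (t := Λ)
          (g := lab k₀) (fun i hi => Finset.mem_image_of_mem _ hi)]
        refine Finset.sum_le_sum fun i hi => ?_
        have h1 := sum_inv_card_fiberAt_le (A := A) (lab k₀)
          (Finset.filter_subset (fun w => lab k₀ w = i) A)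
        have h2 : ((A.filter fun w => lab k₀ w = i).image (lab k₀)).card ≤ 1 := by
          refine Finset.card_le_one.2 fun u hu v hv => ?_
          obtain ⟨u', hu', rfl⟩ := Finset.mem_image.1 hu
          obtain ⟨v', hv', rfl⟩ := Finset.mem_image.1 hv
          rw [(Finset.mem_filter.1 hu').2, (Finset.mem_filter.1 hv').2]
        have h3 : ∑ z ∈ A.filter (fun w => lab k₀ w = i),
            b (lab k₀ z) * ((fiberAt A (lab k₀) z).card : ℝ)⁻¹ =
            b i * ∑ z ∈ A.filter (fun w => lab k₀ w = i),
              ((fiberAt A (lab k₀) z).card : ℝ)⁻¹ := by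
          rw [Finset.mul_sum]
          refine Finset.sum_congr rfl fun w hw => ?_
          rw [(Finset.mem_filter.1 hw).2]
        rw [h3]
        have h4 := h1.trans (Nat.cast_le.2 h2)
        rw [Nat.cast_one] at h4
        exact mul_le_of_le_one_right (hbpos i hi).le h4
      have h5 := mul_le_mul_of_nonneg_left this (div_pos hcA hBpos).le
      rw [div_mul_cancel₀ _ hBpos.ne'] at h5
      simp only [Finset.sum_const, nsmul_eq_mul]
      linarith
    -- Distinct labels in one residue class differ by at least g. The best class keeps a proportion
    -- 1/g of the total, which is the loss log g per level.
    obtain ⟨c, hc⟩ := exists_residue_class_sum_ge hg Λ b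
    set Λc := Λ.filter (fun i => i % (g : ℤ) = c) with hΛc
    have hΛcsub : ∀ i ∈ Λc, i ∈ Λ := fun i hi => (Finset.mem_filter.1 hi).1
    set S := Λc.biUnion fun i => T (rep (top i)) with hS
    have hTcell : ∀ i ∈ Λ, ∀ w ∈ T (rep (top i)),
        w ∈ A ∧ cell (k₀ + 1) w = cell (k₀ + 1) (top i) := by
      intro i hi w hw
      have := mem_fiberAt.1 (hTsub _ (rep_mem _ (htopA i hi)) hw)
      exact ⟨this.1, this.2.trans (rep_cell _ (htopA i hi))⟩
    have hTlab : ∀ i ∈ Λ, ∀ w ∈ T (rep (top i)), lab k₀ w = i := by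
      intro i hi w hw
      rw [hlab k₀ _ _ (hTcell i hi w hw).2, htopi i hi]
    have hScard : (S.card : ℝ) = ∑ i ∈ Λc, b i := by
      rw [hS, Finset.card_biUnion, Nat.cast_sum]
      intro i hi j hj hij
      refine Finset.disjoint_left.2 fun w hwi hwj => hij ?_
      rw [← hTlab i (hΛcsub i hi) w hwi, ← hTlab j (hΛcsub j hj) w hwj]
    rw [← hB, ← hScard] at hc
    have hgR : (0 : ℝ) < g := Nat.cast_pos.2 hg
    have hScpos : (0 : ℝ) < S.card := by
      by_contra hneg
      have : (S.card : ℝ) = 0 := le_antisymm (not_lt.1 hneg) (Nat.cast_nonneg _)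
      rw [this, mul_zero] at hc
      linarith
    refine ⟨S, ?_, Finset.card_pos.1 (Nat.cast_pos.1 hScpos), ?_, ?_⟩
    · intro w hw
      obtain ⟨i, hi, hwi⟩ := Finset.mem_biUnion.1 hw
      exact (hTcell i (hΛcsub i hi) w hwi).1
    · intro z hz w hw k hk1 hk2 hkeq hkne
      obtain ⟨i, hi, hzi⟩ := Finset.mem_biUnion.1 hz
      obtain ⟨j, hj, hwj⟩ := Finset.mem_biUnion.1 hw
      have hzl := hTlab i (hΛcsub i hi) z hzi
      have hwl := hTlab j (hΛcsub j hj) w hwj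
      rcases eq_or_ne i j with rfl | hij
      · rcases Nat.eq_or_lt_of_le hk1 with rfl | hk
        · exact absurd ((hTcell i (hΛcsub i hi) z hzi).2.trans
            (hTcell i (hΛcsub i hi) w hwj).2.symm) hkne
        · exact hTsep _ (rep_mem _ (htopA i (hΛcsub i hi))) z hzi w hwj k hk (by omega) hkeq hkne
      -- Points with different labels at level k₀ are already in different cells of level k₀ + 1, so
      -- they cannot split later.
      · have hk : k = k₀ := by
          by_contra hne
          have hdeep : ∀ d, cell (k₀ + 1 + d) z = cell (k₀ + 1 + d) w →
              cell (k₀ + 1) z = cell (k₀ + 1) w := by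
            intro d
            induction d with
            | zero => exact id
            | succ d ihd => exact fun h => ihd (hnest _ _ _ h)
          obtain ⟨d, rfl⟩ : ∃ d, k = k₀ + 1 + d := ⟨k - (k₀ + 1), by omega⟩
          have := hlab k₀ _ _ (hdeep d hkeq)
          rw [hzl, hwl] at this
          exact hij this
        subst hk
        rw [hzl, hwl]
        exact le_abs_sub_of_emod_eq (Finset.mem_filter.1 hi).2 (Finset.mem_filter.1 hj).2 hij
    · have hhead : ∀ z ∈ A, (Real.log (fiberAt A (cell (k₀ + 0)) z).card -
          Real.log (fiberAt A (fun w => (cell (k₀ + 0) w, lab (k₀ + 0) w)) z).card) =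
          Real.log A.card - Real.log (fiberAt A (lab k₀) z).card := by
        intro z hz
        congr 4
        · ext v
          simp only [mem_fiberAt, add_zero, and_iff_left_iff_imp]
          exact fun hv => hroot v hv z hz
        · ext v
          simp only [mem_fiberAt, add_zero, Prod.mk.injEq]
          exact ⟨fun h => ⟨h.1, h.2.2⟩, fun h => ⟨h.1, hroot v h.1 z hz, h.2⟩⟩
      have hsplit : ∑ z ∈ A, ∑ i ∈ Finset.range (n + 1),
          (Real.log (fiberAt A (cell (k₀ + i)) z).card -
            Real.log (fiberAt A (fun w => (cell (k₀ + i) w, lab (k₀ + i) w)) z).card) =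
          ∑ z ∈ A, (∑ i ∈ Finset.range n,
            (Real.log (fiberAt A (cell (k₀ + 1 + i)) z).card -
            Real.log (fiberAt A
              (fun w => (cell (k₀ + 1 + i) w, lab (k₀ + 1 + i) w)) z).card)) +
          ∑ z ∈ A, (Real.log A.card - Real.log (fiberAt A (lab k₀) z).card) := by
        rw [← Finset.sum_add_distrib]
        refine Finset.sum_congr rfl fun z hz => ?_
        rw [Finset.sum_range_succ', hhead z hz]
        congr 1
        refine Finset.sum_congr rfl fun i _ => ?_
        rw [show k₀ + (i + 1) = k₀ + 1 + i by ring]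
      have hmono : ∑ z ∈ A, (Real.log (T (rep z)).card + n * Real.log g) ≤
          ∑ z ∈ A, (Real.log (b (lab k₀ z)) + n * Real.log g) := by
        refine Finset.sum_le_sum fun z hz => ?_
        have hi : lab k₀ z ∈ Λ := Finset.mem_image_of_mem _ hz
        have : Real.log (T (rep z)).card ≤ Real.log (b (lab k₀ z)) :=
          Real.log_le_log (Nat.cast_pos.2 (Finset.card_pos.2 (hTne _ (rep_mem z hz))))
            (Nat.cast_le.2 (htopmax _ hi z hz rfl))
        linarith
      have hlogB : Real.log B ≤ Real.log g + Real.log S.card := by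
        rw [← Real.log_mul hgR.ne' hScpos.ne']
        exact Real.log_le_log hBpos hc
      rw [hsplit]
      rw [Finset.sum_add_distrib] at hmono hgibbs htail
      simp only [Finset.sum_add_distrib, Finset.sum_const, nsmul_eq_mul] at hmono hgibbs htail
      have h6 := mul_le_mul_of_nonneg_left hlogB hcA.le
      push_cast
      nlinarith [htail, hmono, hgibbs, h6]

/-- Some cell carries, up to level `n`, a counting measure of exponent `log v`. -/
theorem exists_cell_card_mul_pow_le (S : Finset α) (hS : S.Nonempty) (cell : ℕ → α → ι) {v : ℝ}
    (hv : 1 ≤ v) {j₀ n : ℕ} (hj : j₀ ≤ n) {C : ℝ} (hC : ((S.image (cell j₀)).card : ℝ) ≤ C) :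
    ∃ j, j₀ ≤ j ∧ j ≤ n ∧ ∃ z₀ ∈ S,
      (∀ i, j + i ≤ n → ∀ z ∈ S,
        ((fiberAt S (cell (j + i)) z).card : ℝ) * v ^ i ≤ (fiberAt S (cell j) z₀).card) ∧
      (S.card : ℝ) ≤ C * ((fiberAt S (cell j) z₀).card * v ^ j) := by
  have hvpos : 0 < v := by linarith
  -- Maximising |cell| v^level makes the cell Frostman: a subcell that is too heavy would have a
  -- larger weight. Comparison with the cells of level j₀ gives the size bound.
  obtain ⟨⟨j, z₀⟩, hmem, hmax⟩ := Finset.exists_max_image (Finset.Icc j₀ n ×ˢ S)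
    (fun p => ((fiberAt S (cell p.1) p.2).card : ℝ) * v ^ p.1)
    (Finset.Nonempty.product ⟨j₀, by simpa using hj⟩ hS)
  obtain ⟨hjm, hz₀⟩ := Finset.mem_product.1 hmem
  obtain ⟨hj1, hj2⟩ := Finset.mem_Icc.1 hjm
  refine ⟨j, hj1, hj2, z₀, hz₀, fun i hi z hz => ?_, ?_⟩
  · have := hmax (j + i, z) (Finset.mem_product.2 ⟨Finset.mem_Icc.2 ⟨by simp; omega, hi⟩, hz⟩)
    simp only [pow_add] at this
    have hp : 0 < v ^ j := pow_pos hvpos j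
    refine le_of_mul_le_mul_right ?_ hp
    linarith
  · set M := ((fiberAt S (cell j) z₀).card : ℝ) * v ^ j with hM
    have hM0 : 0 ≤ M := by positivity
    have h1 : S.card = ∑ c ∈ S.image (cell j₀), (S.filter fun z => cell j₀ z = c).card :=
      Finset.card_eq_sum_card_image _ _
    rw [h1, Nat.cast_sum]
    calc _ ≤ ∑ c ∈ S.image (cell j₀), M := by
          refine Finset.sum_le_sum fun c hc => ?_
          obtain ⟨z, hz, rfl⟩ := Finset.mem_image.1 hc
          refine le_trans ?_ (hmax (j₀, z) (Finset.mem_product.2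
            ⟨Finset.mem_Icc.2 ⟨le_rfl, hj⟩, hz⟩))
          exact le_mul_of_one_le_right (Nat.cast_nonneg _) (one_le_pow₀ hv)
      _ = (S.image (cell j₀)).card * M := by rw [Finset.sum_const, nsmul_eq_mul]
      _ ≤ C * M := mul_le_mul_of_nonneg_right hC hM0

end Selection

/-! ### Digit cells of invariant sets, their growth and the total deficit. -/

section Cells

/-- A subset of `[0, 1)` that is mapped into itself by `x ↦ r x (mod 1)`. -/
structure IsFractInvariant (r : ℕ) (X : Set ℝ) : Prop where
  subset_Ico : X ⊆ Ico 0 1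
  fract_mem : ∀ x ∈ X, Int.fract ((r : ℝ) * x) ∈ X

/-- The index of the interval `[i r⁻ʲ, (i + 1) r⁻ʲ)` that contains `x`. -/
noncomputable def digitCell (r j : ℕ) (x : ℝ) : ℤ := ⌊(r : ℝ) ^ j * x⌋

theorem fract_pow_add (r j l : ℕ) (x : ℝ) : Int.fract ((r : ℝ) ^ (j + l) * x) =
    Int.fract ((r : ℝ) ^ l * Int.fract ((r : ℝ) ^ j * x)) := by
  have : (r : ℝ) ^ l * Int.fract ((r : ℝ) ^ j * x) =
      (r : ℝ) ^ (j + l) * x - (((r : ℤ) ^ l * ⌊(r : ℝ) ^ j * x⌋ : ℤ) : ℝ) := by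
    rw [Int.fract]; push_cast; ring
  rw [this, Int.fract_sub_intCast]

theorem IsFractInvariant.fract_pow_mem {r : ℕ} {X : Set ℝ} (hX : IsFractInvariant r X) (j : ℕ)
    {x : ℝ} (hx : x ∈ X) : Int.fract ((r : ℝ) ^ j * x) ∈ X := by
  induction j with
  | zero =>
    rw [pow_zero, one_mul, Int.fract_eq_self.2 ⟨(hX.subset_Ico hx).1, (hX.subset_Ico hx).2⟩]
    exact hx
  | succ j ih => rw [fract_pow_add, pow_one]; exact hX.fract_mem _ ih

theorem IsFractInvariant.pow {r : ℕ} {X : Set ℝ} (hX : IsFractInvariant r X) (j : ℕ) :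
    IsFractInvariant (r ^ j) X :=
  ⟨hX.subset_Ico, fun x hx => by simpa using hX.fract_pow_mem j hx⟩

theorem digitCell_pow (r j n : ℕ) (x : ℝ) : digitCell (r ^ j) n x = digitCell r (j * n) x := by
  simp [digitCell, pow_mul]

theorem digitCell_add (r j l : ℕ) (x : ℝ) : digitCell r (j + l) x =
    (r : ℤ) ^ l * digitCell r j x + digitCell r l (Int.fract ((r : ℝ) ^ j * x)) := by
  have : (r : ℝ) ^ (j + l) * x =
      (((r : ℤ) ^ l * digitCell r j x : ℤ) : ℝ) + (r : ℝ) ^ l * Int.fract ((r : ℝ) ^ j * x) := by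
    rw [Int.fract, digitCell]; push_cast; ring
  rw [digitCell, this, Int.floor_intCast_add]
  rfl

theorem digitCell_mem_Ico {r : ℕ} (hr : 0 < r) (j : ℕ) {x : ℝ} (hx : x ∈ Ico (0 : ℝ) 1) :
    digitCell r j x ∈ Finset.Ico (0 : ℤ) ((r : ℤ) ^ j) := by
  have hp : (0 : ℝ) < (r : ℝ) ^ j := pow_pos (Nat.cast_pos.2 hr) j
  rw [Finset.mem_Ico]
  refine ⟨Int.floor_nonneg.2 (mul_nonneg hp.le hx.1), Int.floor_lt.2 ?_⟩
  push_cast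
  exact mul_lt_of_lt_one_right hp hx.2

theorem digitCell_eq_ediv {r : ℕ} (hr : 0 < r) (j l : ℕ) (x : ℝ) :
    digitCell r j x = digitCell r (j + l) x / (r : ℤ) ^ l := by
  have hp : (0 : ℤ) < (r : ℤ) ^ l := pow_pos (by exact_mod_cast hr) l
  have h := Finset.mem_Ico.1 (digitCell_mem_Ico hr l
    (x := Int.fract ((r : ℝ) ^ j * x)) ⟨Int.fract_nonneg _, Int.fract_lt_one _⟩)
  rw [digitCell_add, Int.mul_add_ediv_left _ _ hp.ne', Int.ediv_eq_zero_of_lt h.1 h.2, add_zero]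

theorem digitCell_eq_of_le {r : ℕ} (hr : 0 < r) {j l : ℕ} (h : j ≤ l) {x y : ℝ}
    (hxy : digitCell r l x = digitCell r l y) : digitCell r j x = digitCell r j y := by
  obtain ⟨d, rfl⟩ := Nat.exists_eq_add_of_le h
  rw [digitCell_eq_ediv hr j d x, digitCell_eq_ediv hr j d y, hxy]

theorem abs_sub_lt_of_digitCell_eq {r j : ℕ} (hr : 0 < r) {x y : ℝ}
    (h : digitCell r j x = digitCell r j y) : |x - y| < ((r : ℝ) ^ j)⁻¹ := by
  have hp : (0 : ℝ) < (r : ℝ) ^ j := pow_pos (Nat.cast_pos.2 hr) j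
  have := Int.abs_sub_lt_one_of_floor_eq_floor h
  rw [← mul_sub, abs_mul, abs_of_pos hp] at this
  rwa [← one_div, lt_div_iff₀' hp]

theorem abs_digitCell_sub_le_one {r j : ℕ} {x y : ℝ}
    (h : (r : ℝ) ^ j * |x - y| ≤ 1) : |digitCell r j x - digitCell r j y| ≤ 1 := by
  have h0 : |(r : ℝ) ^ j * x - (r : ℝ) ^ j * y| ≤ 1 := by
    rw [← mul_sub, abs_mul, abs_of_nonneg (by positivity)]; exact h
  have h1 := Int.floor_le ((r : ℝ) ^ j * x)
  have h2 := Int.lt_floor_add_one ((r : ℝ) ^ j * x)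
  have h3 := Int.floor_le ((r : ℝ) ^ j * y)
  have h4 := Int.lt_floor_add_one ((r : ℝ) ^ j * y)
  rw [abs_le] at h0 ⊢
  constructor
  · have : ((digitCell r j y : ℝ)) < digitCell r j x + 2 := by unfold digitCell; linarith
    have : digitCell r j y < digitCell r j x + 2 := by exact_mod_cast this
    omega
  · have : ((digitCell r j x : ℝ)) < digitCell r j y + 2 := by unfold digitCell; linarith
    have : digitCell r j x < digitCell r j y + 2 := by exact_mod_cast this
    omega

open Classical in
/-- The cells of level `n` that meet `X`. -/
noncomputable def cellFinset (r : ℕ) (X : Set ℝ) (n : ℕ) : Finset ℤ :=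
  (Finset.Ico (0 : ℤ) ((r : ℤ) ^ n)).filter (· ∈ digitCell r n '' X)

theorem IsFractInvariant.mem_cellFinset {r : ℕ} {X : Set ℝ} (hX : IsFractInvariant r X)
    (hr : 0 < r) {n : ℕ} {c : ℤ} : c ∈ cellFinset r X n ↔ ∃ x ∈ X, digitCell r n x = c := by
  classical
  rw [cellFinset, Finset.mem_filter, mem_image]
  refine ⟨fun h => h.2, fun h => ⟨?_, h⟩⟩
  obtain ⟨x, hx, rfl⟩ := h
  exact digitCell_mem_Ico hr n (hX.subset_Ico hx)

theorem cellFinset_card_le (r : ℕ) (X : Set ℝ) (n : ℕ) : (cellFinset r X n).card ≤ r ^ n := by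
  classical
  refine (Finset.card_le_card (Finset.filter_subset _ _)).trans ?_
  rw [Int.card_Ico, sub_zero]
  exact_mod_cast le_rfl

theorem cellFinset_pow (r : ℕ) (X : Set ℝ) (j n : ℕ) :
    cellFinset (r ^ j) X n = cellFinset r X (j * n) := by
  classical
  unfold cellFinset
  have : digitCell (r ^ j) n = digitCell r (j * n) := funext fun x => digitCell_pow r j n x
  rw [this]
  push_cast
  rw [pow_mul]

theorem IsFractInvariant.cellFinset_card_pos {r : ℕ} {X : Set ℝ} (hX : IsFractInvariant r X)
    (hr : 0 < r) (hne : X.Nonempty) (n : ℕ) : 0 < (cellFinset r X n).card := by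
  obtain ⟨x, hx⟩ := hne
  exact Finset.card_pos.2 ⟨_, (hX.mem_cellFinset hr).2 ⟨x, hx, rfl⟩⟩

/-- The first j digits and the next l digits of a point of X are both words of X, the latter by
invariance, and together they determine the cell. -/
theorem IsFractInvariant.cellFinset_card_add_le {r : ℕ} {X : Set ℝ} (hX : IsFractInvariant r X)
    (hr : 0 < r) (j l : ℕ) :
    (cellFinset r X (j + l)).card ≤ (cellFinset r X j).card * (cellFinset r X l).card := by
  rw [← Finset.card_product]
  refine Finset.card_le_card_of_surjOn (fun p => (r : ℤ) ^ l * p.1 + p.2) fun c hc => ?_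
  obtain ⟨x, hx, rfl⟩ := (hX.mem_cellFinset hr).1 hc
  refine ⟨(digitCell r j x, digitCell r l (Int.fract ((r : ℝ) ^ j * x))), ?_,
    (digitCell_add r j l x).symm⟩
  rw [Finset.mem_coe, Finset.mem_product]
  exact ⟨(hX.mem_cellFinset hr).2 ⟨x, hx, rfl⟩,
    (hX.mem_cellFinset hr).2 ⟨_, hX.fract_pow_mem j hx, rfl⟩⟩

theorem IsFractInvariant.cellFinset_card_le_pow {r : ℕ} {X : Set ℝ} (hX : IsFractInvariant r X)
    (hr : 0 < r) (n : ℕ) : (cellFinset r X n).card ≤ (cellFinset r X 1).card ^ n := by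
  induction n with
  | zero => simpa using cellFinset_card_le r X 0
  | succ n ih =>
    rw [pow_succ]
    exact (hX.cellFinset_card_add_le hr n 1).trans (Nat.mul_le_mul_right _ ih)

/-- The j-th iterate of the map blows a cell of level j up to unit size and stays in X, so the cell
has no more subcells than X itself. -/
theorem IsFractInvariant.card_image_fiberAt_le {r : ℕ} {X : Set ℝ} (hX : IsFractInvariant r X)
    (hr : 0 < r) {P : Finset ℝ} (hP : ∀ x ∈ P, x ∈ X) (j l : ℕ) (x : ℝ) :
    ((fiberAt P (digitCell r j) x).image (digitCell r (j + l))).card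
      ≤ (cellFinset r X l).card := by
  refine Finset.card_le_card_of_surjOn (fun d => (r : ℤ) ^ l * digitCell r j x + d) fun c hc => ?_
  obtain ⟨y, hy, rfl⟩ := Finset.mem_image.1 hc
  obtain ⟨hyP, hyx⟩ := mem_fiberAt.1 hy
  refine ⟨digitCell r l (Int.fract ((r : ℝ) ^ j * y)), ?_, ?_⟩
  · exact (hX.mem_cellFinset hr).2 ⟨_, hX.fract_pow_mem j (hP y hyP), rfl⟩
  · simp only
    rw [← hyx, digitCell_add]

theorem IsFractInvariant.card_image_fiberAt_le_exp {r : ℕ} {X : Set ℝ}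
    (hX : IsFractInvariant r X) (hne : X.Nonempty)
    (hr : 0 < r) {P : Finset ℝ} (hP : ∀ x ∈ P, x ∈ X) (j l : ℕ) (x : ℝ) :
    (((fiberAt P (digitCell r j) x).image (digitCell r (j + l))).card : ℝ)
      ≤ Real.exp (l * Real.log (cellFinset r X 1).card) := by
  have hpos : (0 : ℝ) < (cellFinset r X 1).card :=
    Nat.cast_pos.2 (hX.cellFinset_card_pos hr hne 1)
  rw [← Real.log_pow, Real.exp_log (pow_pos hpos l)]
  exact_mod_cast (hX.card_image_fiberAt_le hr hP j l x).trans (hX.cellFinset_card_le_pow hr l)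

/-- The sum over a sequence of levels of the deficits is at most the total defect of entropy. -/
theorem IsFractInvariant.sum_deficit_le {r : ℕ} {X : Set ℝ} (hX : IsFractInvariant r X)
    (hne : X.Nonempty) (hr : 0 < r) {P : Finset ℝ} (hP : ∀ x ∈ P, x ∈ X) {q : ℕ → ℕ} {e : ℕ}
    (hq0 : q 0 = 0) (hq : ∀ k, q k + e ≤ q (k + 1)) {n : ℕ}
    (hinj : ∀ x ∈ P, ∀ y ∈ P, digitCell r (q n) x = digitCell r (q n) y → x = y) :
    ∑ k ∈ Finset.range n, ∑ x ∈ P, deficit P (digitCell r (q k)) (digitCell r (q k + e))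
        (e * Real.log (cellFinset r X 1).card) x
      ≤ P.card * (q n * Real.log (cellFinset r X 1).card - Real.log P.card + 3 * n) := by
  set a := Real.log (cellFinset r X 1).card with ha
  set φ : ℕ → ℝ := fun j => ∑ x ∈ P, Real.log (fiberAt P (digitCell r j) x).card with hφ
  have hstep : ∀ k, ∑ x ∈ P, deficit P (digitCell r (q k)) (digitCell r (q k + e)) (e * a) x
      ≤ P.card * (((q (k + 1) : ℝ) - q k) * a + 3) - (φ (q k) - φ (q (k + 1))) := by
    intro k
    have h1 := _root_.sum_deficit_le P (digitCell r (q k)) (digitCell r (q k + e))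
      (fun x y h => digitCell_eq_of_le hr (Nat.le_add_right _ _) h) (c := e * a)
      (fun x _ => hX.card_image_fiberAt_le_exp hne hr hP (q k) e x)
    obtain ⟨d, hd⟩ := Nat.exists_eq_add_of_le (hq k)
    -- The levels between q k + e and q (k + 1) lose no more entropy than the maximal branching
    -- allows; adding this to the deficit bound makes the differences of φ telescope.
    have h2 := sum_log_fiberAt_ratio_le P (digitCell r (q k + e)) (digitCell r (q k + e + d))
      (Real.exp_pos _) (fun x _ => hX.card_image_fiberAt_le_exp hne hr hP (q k + e) d x)
    rw [Real.log_exp] at h2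
    rw [Finset.sum_sub_distrib] at h1 h2
    rw [hd]
    push_cast
    simp only [hφ]
    linarith
  have hsum : ∀ n, ∑ k ∈ Finset.range n, ∑ x ∈ P,
      deficit P (digitCell r (q k)) (digitCell r (q k + e)) (e * a) x
      ≤ P.card * (q n * a + 3 * n) - φ 0 + φ (q n) := by
    intro n
    induction n with
    | zero => simp [hq0]
    | succ n ih =>
      rw [Finset.sum_range_succ]
      have := hstep n
      push_cast
      linarith
  have h0 : φ 0 = P.card * Real.log P.card := by
    rw [← nsmul_eq_mul, ← Finset.sum_const]
    refine Finset.sum_congr rfl fun x hx => ?_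
    congr 3
    refine Finset.filter_true_of_mem fun y hy => ?_
    have : ∀ z ∈ P, digitCell r 0 z = 0 := fun z hz => by
      have := Finset.mem_Ico.1 (digitCell_mem_Ico hr 0 (hX.subset_Ico (hP z hz)))
      rw [pow_zero] at this
      omega
    rw [this x hx, this y hy]
  have hn : φ (q n) = 0 := by
    refine Finset.sum_eq_zero fun x hx => ?_
    have : fiberAt P (digitCell r (q n)) x = {x} := by
      ext y
      rw [mem_fiberAt, Finset.mem_singleton]
      exact ⟨fun h => hinj y h.1 x hx h.2, fun h => by subst h; exact ⟨hx, rfl⟩⟩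
    rw [this]
    simp
  have := hsum n
  rw [h0, hn] at this
  linarith

/-- A choice of one point of `X` in each cell of level `n`. -/
theorem IsFractInvariant.exists_cell_representatives {r : ℕ} {X : Set ℝ}
    (hX : IsFractInvariant r X) (hr : 0 < r) (n : ℕ) :
    ∃ P : Finset ℝ, (∀ x ∈ P, x ∈ X) ∧ P.card = (cellFinset r X n).card ∧
      ∀ x ∈ P, ∀ y ∈ P, digitCell r n x = digitCell r n y → x = y := by
  classical
  have h : ∀ c ∈ cellFinset r X n, ∃ x ∈ X, digitCell r n x = c :=
    fun c hc => (hX.mem_cellFinset hr).1 hc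
  choose! x hx hxc using h
  refine ⟨(cellFinset r X n).image x, ?_, ?_, ?_⟩
  · intro y hy
    obtain ⟨c, hc, rfl⟩ := Finset.mem_image.1 hy
    exact hx c hc
  · refine Finset.card_image_of_injOn fun c hc d hd hcd => ?_
    rw [← hxc c hc, ← hxc d hd, hcd]
  · intro y hy z hz hyz
    obtain ⟨c, hc, rfl⟩ := Finset.mem_image.1 hy
    obtain ⟨d, hd, rfl⟩ := Finset.mem_image.1 hz
    rw [hxc c hc, hxc d hd] at hyz
    rw [hyz]

end Cells

/-! ### A discrete Marstrand projection argument at one level. -/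

section Energy

/-- The pair of the cells of level `p` (base `r`) and `q` (base `s`) of the coordinates. -/
noncomputable def pairCell (r s p q : ℕ) (z : ℝ × ℝ) : ℤ × ℤ :=
  (digitCell r p z.1, digitCell s q z.2)

/-- The approximate projection `x + τ y` of the corner of the cell of a point. -/
noncomputable def cornerProj (r s p q : ℕ) (τ : ℝ) (z : ℝ × ℝ) : ℝ :=
  digitCell r p z.1 + τ * ((r : ℝ) ^ p / (s : ℝ) ^ q) * digitCell s q z.2

/-- The integer part of the approximate projection. -/
noncomputable def projLabel (r s p q : ℕ) (τ : ℝ) (z : ℝ × ℝ) : ℤ := ⌊cornerProj r s p q τ z⌋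

/-- Moving to the corners changes each rescaled coordinate by a fractional part. The first
contributes at most 1; the second is multiplied by |τ| ≤ 2 and by r^p / s^q ≤ s. -/
theorem abs_proj_sub_cornerProj_le {r s p q : ℕ} (hs : 0 < s) {τ : ℝ} (hτ : |τ| ≤ 2)
    (hpq : (r : ℝ) ^ p ≤ (s : ℝ) ^ (q + 1)) (z w : ℝ × ℝ) :
    |(r : ℝ) ^ p * (z.1 - w.1 + τ * (z.2 - w.2)) -
      (cornerProj r s p q τ z - cornerProj r s p q τ w)| ≤ 1 + 2 * s := by
  have hsq : (0 : ℝ) < (s : ℝ) ^ q := pow_pos (Nat.cast_pos.2 hs) q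
  set c := (r : ℝ) ^ p / (s : ℝ) ^ q with hc
  have hc0 : 0 ≤ c := by positivity
  have hcs : c ≤ s := by
    rw [hc, div_le_iff₀ hsq, ← pow_succ']; exact hpq
  have hrc : (r : ℝ) ^ p = c * (s : ℝ) ^ q := by rw [hc, div_mul_cancel₀ _ hsq.ne']
  have e : (r : ℝ) ^ p * (z.1 - w.1 + τ * (z.2 - w.2)) -
      (cornerProj r s p q τ z - cornerProj r s p q τ w) =
      (Int.fract ((r : ℝ) ^ p * z.1) - Int.fract ((r : ℝ) ^ p * w.1)) +
      τ * (c * (Int.fract ((s : ℝ) ^ q * z.2) - Int.fract ((s : ℝ) ^ q * w.2))) := by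
    have h1 : (r : ℝ) ^ p * (τ * (z.2 - w.2)) =
        τ * (c * ((s : ℝ) ^ q * z.2 - (s : ℝ) ^ q * w.2)) := by rw [hrc]; ring
    simp only [cornerProj, digitCell, Int.fract, ← hc]
    rw [mul_add, h1]
    ring
  have hf : ∀ a b : ℝ, |Int.fract a - Int.fract b| ≤ 1 := fun a b => by
    have := Int.fract_nonneg a
    have := Int.fract_nonneg b
    have := Int.fract_lt_one a
    have := Int.fract_lt_one b
    rw [abs_le]; constructor <;> linarith
  rw [e]
  refine (abs_add_le _ _).trans (add_le_add (hf _ _) ?_)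
  rw [abs_mul, abs_mul, abs_of_nonneg hc0]
  have h2 : c * |Int.fract ((s : ℝ) ^ q * z.2) - Int.fract ((s : ℝ) ^ q * w.2)| ≤ s * 1 :=
    mul_le_mul hcs (hf _ _) (abs_nonneg _) (Nat.cast_nonneg _)
  calc _ ≤ 2 * (s * 1 : ℝ) := mul_le_mul hτ h2 (by positivity) (by norm_num)
    _ = _ := by ring

theorem abs_proj_lt_of_projLabel_eq {r s p q : ℕ} (hr : 0 < r) (hs : 0 < s) {τ : ℝ}
    (hτ : |τ| ≤ 2) (hpq : (r : ℝ) ^ p ≤ (s : ℝ) ^ (q + 1)) {z w : ℝ × ℝ}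
    (h : projLabel r s p q τ z = projLabel r s p q τ w) :
    |z.1 - w.1 + τ * (z.2 - w.2)| < (2 + 2 * s) / (r : ℝ) ^ p := by
  have hp : (0 : ℝ) < (r : ℝ) ^ p := pow_pos (Nat.cast_pos.2 hr) p
  have h1 := Int.abs_sub_lt_one_of_floor_eq_floor h
  have h2 := abs_proj_sub_cornerProj_le hs hτ hpq z w
  rw [lt_div_iff₀' hp, ← abs_of_pos hp, ← abs_mul]
  rw [abs_lt] at h1 ⊢
  rw [abs_le] at h2
  constructor <;> linarith

/-- Of the gap g, the integer parts lose 1 and the passage to corners loses 1 + 2s. -/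
theorem le_abs_proj_of_projLabel {r s p q : ℕ} (hr : 0 < r) (hs : 0 < s) {τ : ℝ}
    (hτ : |τ| ≤ 2) (hpq : (r : ℝ) ^ p ≤ (s : ℝ) ^ (q + 1)) {z w : ℝ × ℝ} {g : ℕ}
    (h : (g : ℤ) ≤ |projLabel r s p q τ z - projLabel r s p q τ w|) :
    ((g : ℝ) - 2 - 2 * s) / (r : ℝ) ^ p ≤ |z.1 - w.1 + τ * (z.2 - w.2)| := by
  have hp : (0 : ℝ) < (r : ℝ) ^ p := pow_pos (Nat.cast_pos.2 hr) p
  have h2 := abs_proj_sub_cornerProj_le hs hτ hpq z w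
  have hz1 := Int.floor_le (cornerProj r s p q τ z)
  have hz2 := Int.lt_floor_add_one (cornerProj r s p q τ z)
  have hw1 := Int.floor_le (cornerProj r s p q τ w)
  have hw2 := Int.lt_floor_add_one (cornerProj r s p q τ w)
  have h' : (g : ℝ) ≤ |(projLabel r s p q τ z : ℝ) - projLabel r s p q τ w| := by
    exact_mod_cast h
  rw [div_le_iff₀' hp, ← abs_of_pos hp, ← abs_mul]
  unfold projLabel at h'
  rw [abs_le] at h2
  rw [le_abs] at h' ⊢
  rcases h' with h' | h'
  · left; linarith
  · right; linarith

/-- The values form a progression of step |v| / m, and those counted lie in an interval of length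
2ε. -/
theorem card_filter_abs_lt_le (m : ℕ) (hm : 0 < m) (u v ε : ℝ) (hv : v ≠ 0) (hε : 0 < ε) :
    (((Finset.range m).filter fun i : ℕ => |u + (1 + (i : ℝ) / m) * v| < ε).card : ℝ)
      ≤ 2 * ε * m / |v| + 1 := by
  set T := (Finset.range m).filter fun i : ℕ => |u + (1 + (i : ℝ) / m) * v| < ε with hT
  have hm' : (0 : ℝ) < m := Nat.cast_pos.2 hm
  have hv' : 0 < |v| := abs_pos.2 hv
  rcases T.eq_empty_or_nonempty with h | h
  · rw [h, Finset.card_empty, Nat.cast_zero]; positivity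
  have h1 : T ⊆ Finset.Icc (T.min' h) (T.max' h) := fun i hi =>
    Finset.mem_Icc.2 ⟨T.min'_le i hi, T.le_max' i hi⟩
  have hle : T.min' h ≤ T.max' h := T.min'_le _ (T.max'_mem h)
  have h2 := Finset.card_le_card h1
  rw [Nat.card_Icc] at h2
  have h3 : (T.card : ℝ) ≤ (T.max' h : ℝ) - T.min' h + 1 := by
    have : T.card + T.min' h ≤ T.max' h + 1 := by omega
    have : (T.card : ℝ) + T.min' h ≤ T.max' h + 1 := by exact_mod_cast this
    linarith
  have ha := (Finset.mem_filter.1 (T.min'_mem h)).2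
  have hb := (Finset.mem_filter.1 (T.max'_mem h)).2
  have h4 : |((T.max' h : ℝ) - T.min' h) / m * v| < 2 * ε := by
    have : ((T.max' h : ℝ) - T.min' h) / m * v =
      (u + (1 + (T.max' h : ℝ) / m) * v) - (u + (1 + (T.min' h : ℝ) / m) * v) := by ring
    rw [this]
    exact (abs_sub _ _).trans_lt (by linarith)
  rw [abs_mul, abs_of_nonneg (div_nonneg (sub_nonneg.2 (by exact_mod_cast hle)) hm'.le),
    ← lt_div_iff₀ hv', div_lt_iff₀ hm'] at h4
  have : 2 * ε / |v| * m = 2 * ε * m / |v| := by ring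
  linarith

/-- Any two points of a common cell are adjacent at some scale `l ≤ N` that bounds the number
of directions in which their projections nearly coincide. -/
theorem exists_scale_card_directions_le {r s p q N : ℕ} (hr : 0 < r) (hs : 0 < s)
    (hpq : s ^ q ≤ r ^ p) {e : ℕ → ℕ} (he0 : e 0 = 0) (he : ∀ l, s ^ e l ≤ r ^ l) {σ : ℝ}
    (hσ : |σ| = 1) {z w : ℝ × ℝ} (hzw : pairCell r s p q w = pairCell r s p q z) :
    ∃ l ≤ N, |digitCell r (p + l) w.1 - digitCell r (p + l) z.1| ≤ 1 ∧
      |digitCell s (q + e l) w.2 - digitCell s (q + e l) z.2| ≤ 1 ∧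
      (((Finset.range (r ^ N)).filter fun i : ℕ =>
        |w.1 - z.1 + σ * (1 + (i : ℝ) / (r ^ N : ℕ)) * (w.2 - z.2)|
          < (2 + 2 * s) / (r : ℝ) ^ (p + N)).card : ℝ) ≤
        r ^ N * (33 * s * r * ((r : ℝ) ^ l / (r : ℝ) ^ N)) := by
  classical
  set Good : ℕ → Prop := fun l => |digitCell r (p + l) w.1 - digitCell r (p + l) z.1| ≤ 1 ∧
      |digitCell s (q + e l) w.2 - digitCell s (q + e l) z.2| ≤ 1 with hGood
  set u := w.1 - z.1 with hu
  set v := σ * (w.2 - z.2) with hv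
  set ε := (2 + 2 * s) / (r : ℝ) ^ (p + N) with hε
  have hr1 : (1 : ℝ) ≤ r := by exact_mod_cast hr
  have hs1 : (1 : ℝ) ≤ s := by exact_mod_cast hs
  have hrpos : (0 : ℝ) < r := by linarith
  have hε0 : 0 < ε := by positivity
  have hm : 0 < r ^ N := pow_pos hr N
  have hT : (Finset.range (r ^ N)).filter (fun i : ℕ =>
        |u + σ * (1 + (i : ℝ) / (r ^ N : ℕ)) * (w.2 - z.2)| < ε) =
      (Finset.range (r ^ N)).filter fun i : ℕ => |u + (1 + (i : ℝ) / (r ^ N : ℕ)) * v| < ε := by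
    refine Finset.filter_congr fun i _ => ?_
    rw [hv, show σ * (1 + (i : ℝ) / (r ^ N : ℕ)) * (w.2 - z.2) =
      (1 + (i : ℝ) / (r ^ N : ℕ)) * (σ * (w.2 - z.2)) by ring]
  rw [hT]
  set T := (Finset.range (r ^ N)).filter fun i : ℕ =>
    |u + (1 + (i : ℝ) / (r ^ N : ℕ)) * v| < ε with hTdef
  have hcard : (T.card : ℝ) ≤ (r : ℝ) ^ N := by
    have := Finset.card_filter_le (Finset.range (r ^ N))
      (fun i : ℕ => |u + (1 + (i : ℝ) / (r ^ N : ℕ)) * v| < ε)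
    rw [Finset.card_range] at this
    exact_mod_cast this
  have h0 : Good 0 := by
    simp only [pairCell, Prod.mk.injEq] at hzw
    simp [hGood, he0, hzw.1, hzw.2]
  -- The scale l is the finest one, up to N, at which the points are still adjacent. If l < N,
  -- failure at l + 1 bounds their distance below, and points far apart project close together in
  -- few directions.
  have hl := Nat.findGreatest_spec (P := Good) (Nat.zero_le N) h0
  set l := Nat.findGreatest Good N with hldef
  have hlN : l ≤ N := Nat.findGreatest_le N
  refine ⟨l, hlN, hl.1, hl.2, ?_⟩
  have htriv : 1 ≤ 33 * s * r * ((r : ℝ) ^ l / (r : ℝ) ^ N) →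
      (T.card : ℝ) ≤ r ^ N * (33 * s * r * ((r : ℝ) ^ l / (r : ℝ) ^ N)) := fun h =>
    hcard.trans (le_mul_of_one_le_right (by positivity) h)
  rcases Nat.eq_or_lt_of_le hlN with hlN' | hlN'
  · apply htriv
    rw [hlN', div_self (pow_pos hrpos N).ne']
    nlinarith [mul_le_mul hs1 hr1 zero_le_one (by linarith)]
  have hnot : ¬ Good (l + 1) := Nat.findGreatest_is_greatest (Nat.lt_succ_self l) hlN'
  set B := (r : ℝ) ^ (p + (l + 1)) with hB
  have hB0 : 0 < B := pow_pos hrpos _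
  have hfar : 1 < B * |u| ∨ 1 < B * |v| := by
    by_contra hcon
    push Not at hcon
    refine hnot ⟨abs_digitCell_sub_le_one hcon.1, abs_digitCell_sub_le_one (le_trans ?_ hcon.2)⟩
    have : |v| = |w.2 - z.2| := by rw [hv, abs_mul, hσ, one_mul]
    rw [this]
    refine mul_le_mul_of_nonneg_right ?_ (abs_nonneg _)
    rw [hB, pow_add, pow_add]
    exact_mod_cast Nat.mul_le_mul hpq (he (l + 1))
  have hεB : ε * B = (2 + 2 * s) * (r * ((r : ℝ) ^ l / (r : ℝ) ^ N)) := by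
    rw [hε, hB, pow_add, pow_add, pow_succ]
    field_simp
  set c := (r : ℝ) * ((r : ℝ) ^ l / (r : ℝ) ^ N) with hc
  have hc0 : 0 < c := by positivity
  have hgoal : 33 * s * r * ((r : ℝ) ^ l / (r : ℝ) ^ N) = 33 * s * c := by rw [hc]; ring
  rw [hgoal] at htriv ⊢
  by_cases hbig : 1 ≤ 2 * (ε * B)
  · apply htriv
    rw [hεB] at hbig
    nlinarith
  push Not at hbig
  rcases T.eq_empty_or_nonempty with hTe | ⟨i, hi⟩
  · rw [hTe, Finset.card_empty, Nat.cast_zero]; positivity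
  -- The slopes are at most 2, so if some direction brings the projections within ε, the horizontal
  -- gap is at most ε + 2|v|. The vertical gap is thus large in either case.
  have hvbig : 1 / 4 < B * |v| := by
    rcases hfar with h | h
    · obtain ⟨hir, hi⟩ := Finset.mem_filter.1 hi
      have hir' : (i : ℝ) / (r ^ N : ℕ) ≤ 1 := by
        rw [div_le_one (by exact_mod_cast hm)]
        exact_mod_cast (Finset.mem_range.1 hir).le
      have hir0 : (0 : ℝ) ≤ (i : ℝ) / (r ^ N : ℕ) := by positivity
      have h5 : |u| ≤ ε + 2 * |v| := by
        have h6 : u = (u + (1 + (i : ℝ) / (r ^ N : ℕ)) * v) - (1 + (i : ℝ) / (r ^ N : ℕ)) * v := by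
          ring
        have h7 : |(1 + (i : ℝ) / (r ^ N : ℕ)) * v| ≤ 2 * |v| := by
          rw [abs_mul, abs_of_nonneg (by linarith)]
          exact mul_le_mul_of_nonneg_right (by linarith) (abs_nonneg _)
        calc |u| = _ := congrArg _ h6
          _ ≤ _ := (abs_sub _ _)
          _ ≤ _ := by linarith
      have h8 := mul_le_mul_of_nonneg_left h5 hB0.le
      nlinarith
    · linarith
  have hv0 : v ≠ 0 := by
    rintro h
    rw [h, abs_zero, mul_zero] at hvbig
    linarith
  have h9 := card_filter_abs_lt_le (r ^ N) hm u v ε hv0 hε0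
  refine h9.trans ?_
  have hvpos : 0 < |v| := abs_pos.2 hv0
  have h10 : 2 * ε * (r ^ N : ℕ) / |v| ≤ (r : ℝ) ^ N * (8 * (ε * B)) := by
    rw [div_le_iff₀ hvpos]
    push_cast
    have : 0 < ε * (r : ℝ) ^ N := by positivity
    nlinarith
  have h11 : 1 ≤ (r : ℝ) ^ N * c := by
    have : (r : ℝ) ^ N * c = r * r ^ l := by rw [hc]; field_simp
    rw [this]
    nlinarith [one_le_pow₀ hr1 (n := l)]
  -- Here 33 = 32 + 1: the count contributes 8(2 + 2s) ≤ 32s, and its additive 1 is absorbed in the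
  -- last summand.
  have h12 : (r : ℝ) ^ N * (8 * (ε * B)) + (r : ℝ) ^ N * c ≤ (r : ℝ) ^ N * (33 * s * c) := by
    rw [← mul_add]
    refine mul_le_mul_of_nonneg_left ?_ (by positivity)
    rw [hεB]
    nlinarith
  linarith

/-- Averaged over directions, the entropy of the projection of a product set at scale `r⁻ᴺ` is
at least `γ N log r` up to the deficits of the factors. -/
theorem sum_directions_entropy_ge {r s p q q' N : ℕ} (hr : 1 < r) (hs : 1 < s)
    (hpq : s ^ q ≤ r ^ p) (hpq' : r ^ (p + N) ≤ s ^ (q' + 1))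
    {e : ℕ → ℕ} (he0 : e 0 = 0) (he : ∀ l, s ^ e l ≤ r ^ l) (he' : ∀ l, r ^ l ≤ s ^ (e l + 1))
    {σ : ℝ} (hσ : |σ| = 1) {P Q : Finset ℝ} {z : ℝ × ℝ} (hz : z ∈ P ×ˢ Q)
    {a b α β γ : ℝ} (hβ : 0 ≤ β) (hβ1 : β ≤ 1) (ha : α * Real.log r ≤ a)
    (hb : β * Real.log s ≤ b) (hγ1 : γ ≤ 1) (hγ : γ ≤ α + β) :
    (r : ℝ) ^ N * (γ * (N * Real.log r) - Real.log s
      - ∑ l ∈ Finset.range (N + 1),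
          deficit P (digitCell r p) (digitCell r (p + l)) (l * a) z.1
      - ∑ l ∈ Finset.range (N + 1),
          deficit Q (digitCell s q) (digitCell s (q + e l)) (e l * b) z.2
      - Real.log (33 * s * r * (N + 1))) ≤
    ∑ i ∈ Finset.range (r ^ N),
      (Real.log (fiberAt (P ×ˢ Q) (pairCell r s p q) z).card -
        Real.log (fiberAt (P ×ˢ Q) (fun w => (pairCell r s p q w,
          projLabel r s (p + N) q' (σ * (1 + (i : ℝ) / (r ^ N : ℕ))) w)) z).card) := by
  classical
  have hr0 : 0 < r := by omega
  have hs0 : 0 < s := by omega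
  have hrR : (0 : ℝ) < r := Nat.cast_pos.2 hr0
  have hsR : (0 : ℝ) < s := Nat.cast_pos.2 hs0
  have hm : 0 < r ^ N := pow_pos hr0 N
  have hlr : 0 < Real.log r := Real.log_pos (by exact_mod_cast hr)
  have hls : 0 < Real.log s := Real.log_pos (by exact_mod_cast hs)
  set A := P ×ˢ Q with hA
  set τ : ℕ → ℝ := fun i => σ * (1 + (i : ℝ) / (r ^ N : ℕ)) with hτ
  set F := fiberAt A (pairCell r s p q) z with hF
  set G : ℕ → Finset (ℝ × ℝ) := fun i => fiberAt A (fun w => (pairCell r s p q w,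
          projLabel r s (p + N) q' (τ i) w)) z with hG
  obtain ⟨hz1, hz2⟩ := Finset.mem_product.1 hz
  set Fx := fiberAt P (digitCell r p) z.1 with hFx
  set Fy := fiberAt Q (digitCell s q) z.2 with hFy
  set Nx : ℕ → Finset ℝ := fun l => nbrAt P (digitCell r p) (digitCell r (p + l)) z.1 with hNx
  set Ny : ℕ → Finset ℝ := fun l =>
    nbrAt Q (digitCell s q) (digitCell s (q + e l)) z.2 with hNy
  set dx : ℕ → ℝ := fun l =>
    deficit P (digitCell r p) (digitCell r (p + l)) (l * a) z.1 with hdx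
  set dy : ℕ → ℝ := fun l =>
    deficit Q (digitCell s q) (digitCell s (q + e l)) (e l * b) z.2 with hdy
  set ε := (2 + 2 * (s : ℝ)) / (r : ℝ) ^ (p + N) with hε
  have pFx : (0 : ℝ) < Fx.card := card_fiberAt_pos hz1
  have pFy : (0 : ℝ) < Fy.card := card_fiberAt_pos hz2
  have hFcard : (F.card : ℝ) = Fx.card * Fy.card := by
    have : F = Fx ×ˢ Fy := by
      ext w
      simp only [hF, hFx, hFy, mem_fiberAt, Finset.mem_product, hA, pairCell, Prod.mk.injEq]
      tauto
    rw [this, Finset.card_product, Nat.cast_mul]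
  have pG : ∀ i, (0 : ℝ) < (G i).card := fun i => card_fiberAt_pos hz
  -- the total number of near coincidences
  have hGsub : ∀ i ∈ Finset.range (r ^ N), G i ⊆
      F.filter fun w => |w.1 - z.1 + τ i * (w.2 - z.2)| < ε := by
    intro i hi w hw
    obtain ⟨hwA, hw⟩ := mem_fiberAt.1 hw
    obtain ⟨hw1, hw2⟩ := Prod.mk.inj hw
    refine Finset.mem_filter.2 ⟨mem_fiberAt.2 ⟨hwA, hw1⟩, ?_⟩
    refine abs_proj_lt_of_projLabel_eq hr0 hs0 ?_ (by exact_mod_cast hpq') hw2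
    have hir' : (i : ℝ) / (r ^ N : ℕ) ≤ 1 := by
      rw [div_le_one (by exact_mod_cast hm)]
      exact_mod_cast (Finset.mem_range.1 hi).le
    have hir0 : (0 : ℝ) ≤ (i : ℝ) / (r ^ N : ℕ) := by positivity
    rw [hτ, abs_mul, hσ, one_mul, abs_of_nonneg (by linarith)]
    linarith
  have hsumG : ∑ i ∈ Finset.range (r ^ N), ((G i).card : ℝ) ≤
      ∑ w ∈ F, (((Finset.range (r ^ N)).filter fun i : ℕ =>
        |w.1 - z.1 + τ i * (w.2 - z.2)| < ε).card : ℝ) := by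
    calc _ ≤ ∑ i ∈ Finset.range (r ^ N),
        ((F.filter fun w => |w.1 - z.1 + τ i * (w.2 - z.2)| < ε).card : ℝ) :=
          Finset.sum_le_sum fun i hi => Nat.cast_le.2 (Finset.card_le_card (hGsub i hi))
      _ = _ := by
          simp only [Finset.card_filter, Nat.cast_sum]
          rw [Finset.sum_comm]
  set W : ℕ → ℝ := fun l => 33 * s * r * ((r : ℝ) ^ l / (r : ℝ) ^ N) with hW
  have hW0 : ∀ l, 0 < W l := fun l => by positivity
  -- Summing over all scales l avoids partitioning the points w by their own scale; it costs the
  -- factor N + 1.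
  have hpt : ∀ w ∈ F, (((Finset.range (r ^ N)).filter fun i : ℕ =>
        |w.1 - z.1 + τ i * (w.2 - z.2)| < ε).card : ℝ) ≤
      ∑ l ∈ Finset.range (N + 1), if w ∈ Nx l ×ˢ Ny l then (r : ℝ) ^ N * W l else 0 := by
    intro w hw
    obtain ⟨hwA, hw⟩ := mem_fiberAt.1 hw
    obtain ⟨hw1, hw2⟩ := Finset.mem_product.1 hwA
    obtain ⟨l, hl, h1, h2, h3⟩ := exists_scale_card_directions_le (N := N) hr0 hs0 hpq he0 he hσ hw
    refine h3.trans ?_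
    have hmem : w ∈ Nx l ×ˢ Ny l := by
      simp only [pairCell, Prod.mk.injEq] at hw
      exact Finset.mem_product.2 ⟨Finset.mem_filter.2 ⟨hw1, hw.1, h1⟩,
        Finset.mem_filter.2 ⟨hw2, hw.2, h2⟩⟩
    have := Finset.single_le_sum (s := Finset.range (N + 1))
      (f := fun l => if w ∈ Nx l ×ˢ Ny l then (r : ℝ) ^ N * W l else 0)
      (fun l _ => by
        have := hW0 l
        split_ifs <;> positivity) (Finset.mem_range.2 (Nat.lt_succ_of_le hl))
    simpa only [hmem, if_true] using this
  have hsumG2 : ∑ i ∈ Finset.range (r ^ N), ((G i).card : ℝ) ≤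
      (r : ℝ) ^ N * ∑ l ∈ Finset.range (N + 1), W l * ((Nx l).card * (Ny l).card) := by
    refine (hsumG.trans (Finset.sum_le_sum hpt)).trans ?_
    rw [Finset.sum_comm, Finset.mul_sum]
    refine Finset.sum_le_sum fun l _ => ?_
    rw [← Finset.sum_filter, Finset.sum_const, nsmul_eq_mul]
    have : ((F.filter fun w => w ∈ Nx l ×ˢ Ny l).card : ℝ) ≤ (Nx l).card * (Ny l).card := by
      rw [← Nat.cast_mul, ← Finset.card_product]
      exact Nat.cast_le.2 (Finset.card_le_card fun w hw => (Finset.mem_filter.1 hw).2)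
    have hW' : 0 ≤ (r : ℝ) ^ N * W l := (mul_pos (by positivity) (hW0 l)).le
    calc _ ≤ ((Nx l).card * (Ny l).card : ℝ) * ((r : ℝ) ^ N * W l) :=
          mul_le_mul_of_nonneg_right this hW'
      _ = _ := by ring
  set Dx := ∑ l ∈ Finset.range (N + 1), dx l with hDx
  set Dy := ∑ l ∈ Finset.range (N + 1), dy l with hDy
  set E := Real.exp (-(γ * (N * Real.log r)) + Real.log s + Dx + Dy) with hE
  have hterm : ∀ l ∈ Finset.range (N + 1), W l * ((Nx l).card * (Ny l).card) ≤
      33 * s * r * (Fx.card * Fy.card) * E := by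
    intro l hl
    have hlN : l ≤ N := Nat.lt_succ_iff.1 (Finset.mem_range.1 hl)
    have hlN' : (l : ℝ) ≤ N := by exact_mod_cast hlN
    have hdxn : ∀ l ∈ Finset.range (N + 1), 0 ≤ dx l := fun l _ => le_max_left _ _
    have hdyn : ∀ l ∈ Finset.range (N + 1), 0 ≤ dy l := fun l _ => le_max_left _ _
    have h1 : dx l ≤ Dx := Finset.single_le_sum hdxn hl
    have h2 : dy l ≤ Dy := Finset.single_le_sum hdyn hl
    have h3 : l * a - (Real.log Fx.card - Real.log (Nx l).card) ≤ dx l := le_max_right _ _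
    have h4 : e l * b - (Real.log Fy.card - Real.log (Ny l).card) ≤ dy l := le_max_right _ _
    have pNx : (0 : ℝ) < (Nx l).card := card_nbrAt_pos hz1
    have pNy : (0 : ℝ) < (Ny l).card := card_nbrAt_pos hz2
    have hel : l * Real.log r ≤ (e l + 1) * Real.log s := by
      have := Real.log_le_log (by positivity : (0 : ℝ) < (r : ℝ) ^ l)
        (by exact_mod_cast he' l : (r : ℝ) ^ l ≤ (s : ℝ) ^ (e l + 1))
      rw [Real.log_pow, Real.log_pow] at this
      exact_mod_cast this
    have hla : α * (l * Real.log r) ≤ l * a := by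
      have := mul_le_mul_of_nonneg_left ha (Nat.cast_nonneg l)
      linarith
    have hlb : β * (l * Real.log r) - Real.log s ≤ e l * b := by
      have h5 := mul_le_mul_of_nonneg_left hb (Nat.cast_nonneg (e l))
      have h6 := mul_le_mul_of_nonneg_left hel hβ
      have h7 := mul_le_mul_of_nonneg_right hβ1 hls.le
      linarith
    -- Adjacency at scale l leaves a fraction about r^(-l(α+β)) of the points, and each is bad for
    -- about r^(l-N) of the directions. As γ ≤ 1 and γ ≤ α + β, the product is at most r^(-γN) for
    -- every l, up to deficits and rounding.
    have hmain : γ * (N * Real.log r) ≤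
        (N - l) * Real.log r + α * (l * Real.log r) + β * (l * Real.log r) := by
      have h8 : γ * ((N - l) * Real.log r) ≤ 1 * ((N - l) * Real.log r) :=
        mul_le_mul_of_nonneg_right hγ1 (mul_nonneg (by linarith) hlr.le)
      have h9 : γ * (l * Real.log r) ≤ (α + β) * (l * Real.log r) :=
        mul_le_mul_of_nonneg_right hγ (by positivity)
      linarith
    have hWl : W l = 33 * s * r * Real.exp ((l - N) * Real.log r) := by
      rw [hW, sub_mul, Real.exp_sub, ← Real.log_pow, ← Real.log_pow,
        Real.exp_log (pow_pos hrR l), Real.exp_log (pow_pos hrR N)]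
    have hkey : Real.exp ((l - N) * Real.log r) * ((Nx l).card * (Ny l).card) ≤
        (Fx.card * Fy.card) * E := by
      rw [← Real.exp_log pNx, ← Real.exp_log pNy, ← Real.exp_log pFx, ← Real.exp_log pFy,
        hE, ← Real.exp_add, ← Real.exp_add, ← Real.exp_add, ← Real.exp_add]
      apply Real.exp_le_exp.2
      linarith
    rw [hWl]
    have := mul_le_mul_of_nonneg_left hkey (by positivity : (0 : ℝ) ≤ 33 * s * r)
    linarith
  set c := (N + 1) * (33 * s * r * (Fx.card * Fy.card) * E) with hc
  have hc0 : 0 < c := by positivity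
  have hsumG3 : ∑ i ∈ Finset.range (r ^ N), ((G i).card : ℝ) ≤ (r : ℝ) ^ N * c := by
    refine hsumG2.trans (mul_le_mul_of_nonneg_left ?_ (by positivity))
    refine (Finset.sum_le_sum hterm).trans (le_of_eq ?_)
    rw [Finset.sum_const, Finset.card_range, nsmul_eq_mul, hc]
    push_cast
    ring
  have hlogc : Real.log c = Real.log F.card + Real.log (33 * s * r * (N + 1)) +
      (-(γ * (N * Real.log r)) + Real.log s + Dx + Dy) := by
    have : c = F.card * (33 * s * r * (N + 1)) * E := by rw [hc, hFcard]; ring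
    have hFpos : (0 : ℝ) < F.card := by rw [hFcard]; positivity
    rw [this, Real.log_mul (by positivity) (by positivity), Real.log_mul (by positivity)
      (by positivity), hE, Real.log_exp]
  -- Concavity of log turns the bound for the mean fibre size into one for the mean logarithm, that
  -- is, for the entropy.
  have hlogG : ∑ i ∈ Finset.range (r ^ N), Real.log (G i).card ≤ (r : ℝ) ^ N * Real.log c := by
    calc _ ≤ ∑ i ∈ Finset.range (r ^ N), (Real.log c + (G i).card / c - 1) :=
          Finset.sum_le_sum fun i _ => Real.log_le_log_add_div_sub_one (pG i) hc0
      _ = (r : ℝ) ^ N * Real.log c +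
          (∑ i ∈ Finset.range (r ^ N), ((G i).card : ℝ)) / c - (r : ℝ) ^ N := by
          rw [Finset.sum_sub_distrib, Finset.sum_add_distrib, Finset.sum_div]
          simp
      _ ≤ _ := by
          have := (div_le_iff₀ hc0).2 hsumG3
          linarith
  rw [Finset.sum_sub_distrib, Finset.sum_const, Finset.card_range, nsmul_eq_mul]
  rw [hlogc] at hlogG
  change _ ≤ _ * _ - ∑ i ∈ Finset.range (r ^ N), Real.log (G i).card
  rw [Nat.cast_pow]
  linarith

end Energy

/-! ### Matching levels in both bases; one direction good for many levels. -/

section Frostman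

/-- The level in base `s` that corresponds to the level `p` in base `r`. -/
def matchLevel (r s p : ℕ) : ℕ := Nat.log s (r ^ p)

theorem pow_matchLevel_le {r s : ℕ} (hr : 0 < r) (p : ℕ) : s ^ matchLevel r s p ≤ r ^ p :=
  Nat.pow_log_le_self s (pow_pos hr p).ne'

theorem le_pow_matchLevel_succ {r s : ℕ} (hs : 1 < s) (p : ℕ) :
    r ^ p ≤ s ^ (matchLevel r s p + 1) :=
  (Nat.lt_pow_succ_log_self hs _).le

theorem matchLevel_zero (r s : ℕ) : matchLevel r s 0 = 0 := by simp [matchLevel]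

theorem le_matchLevel {r s : ℕ} (hr : 0 < r) (hs : 1 < s) {p q : ℕ} (h : s ^ q ≤ r ^ p) :
    q ≤ matchLevel r s p :=
  (Nat.le_log_iff_pow_le hs (pow_pos hr p).ne').2 h

theorem matchLevel_mono {r s : ℕ} (hr : 0 < r) : Monotone (matchLevel r s) := fun _ _ h =>
  Nat.log_mono_right (Nat.pow_le_pow_right hr h)

/-- The product cell of level `k`. -/
noncomputable def levelCell (r s N k : ℕ) : ℝ × ℝ → ℤ × ℤ :=
  pairCell r s (N * k) (matchLevel r s (N * k))

/-- The label of the product cells of level `k + 1`. -/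
noncomputable def levelLabel (r s N : ℕ) (τ : ℝ) (k : ℕ) : ℝ × ℝ → ℤ :=
  projLabel r s (N * k + N) (matchLevel r s (N * k + N)) τ

theorem levelCell_eq_of_le {r s N : ℕ} (hr : 0 < r) (hs : 0 < s) {j k : ℕ} (h : j ≤ k)
    {z w : ℝ × ℝ} (hzw : levelCell r s N k z = levelCell r s N k w) :
    levelCell r s N j z = levelCell r s N j w := by
  simp only [levelCell, pairCell, Prod.mk.injEq] at hzw ⊢
  exact ⟨digitCell_eq_of_le hr (Nat.mul_le_mul_left N h) hzw.1,
    digitCell_eq_of_le hs (matchLevel_mono hr (Nat.mul_le_mul_left N h)) hzw.2⟩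

/-- This is why labels are computed from cell corners: they must depend on the cell only. -/
theorem levelLabel_eq {r s N : ℕ} {τ : ℝ} {k : ℕ} {z w : ℝ × ℝ}
    (hzw : levelCell r s N (k + 1) z = levelCell r s N (k + 1) w) :
    levelLabel r s N τ k z = levelLabel r s N τ k w := by
  simp only [levelCell, pairCell, Prod.mk.injEq] at hzw
  have e : N * (k + 1) = N * k + N := Nat.mul_succ N k
  rw [e] at hzw
  simp only [levelLabel, projLabel, cornerProj, hzw.1, hzw.2]

/-- The finite-level form of the projection theorem: in some direction there is a large subset of
the product whose points are separated whenever they split. -/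
theorem exists_direction_separated {r s N : ℕ} (hr : 1 < r) (hs : 1 < s)
    {X Y : Set ℝ} (hX : IsFractInvariant r X) (hY : IsFractInvariant s Y)
    (hXne : X.Nonempty) (hYne : Y.Nonempty) {σ : ℝ} (hσ : |σ| = 1)
    {α β γ γ' ε : ℝ} (hβ : 0 ≤ β) (hβ1 : β ≤ 1) (hε : 0 ≤ ε)
    (hγ1 : γ ≤ 1) (hγ : γ ≤ α + β)
    (hα_le : ∀ n : ℕ, α * (n * Real.log r) ≤ Real.log (cellFinset r X n).card)
    (hβ_le : ∀ n : ℕ, β * (n * Real.log s) ≤ Real.log (cellFinset s Y n).card)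
    (hα_ge : Real.log (cellFinset r X 1).card ≤ (α + ε) * Real.log r)
    (hβ_ge : Real.log (cellFinset s Y 1).card ≤ (β + ε) * Real.log s)
    (hpar : γ' * (N * Real.log r) + Real.log s + Real.log (33 * s * r * (N + 1)) +
      2 * ((N + 1) * (N * (ε * Real.log r) + 3)) + Real.log (2 * s + 4 : ℕ)
        ≤ γ * (N * Real.log r)) (n : ℕ) :
    ∃ t ∈ Icc (1 : ℝ) 2, ∃ S : Finset (ℝ × ℝ), S.Nonempty ∧ (∀ z ∈ S, z.1 ∈ X ∧ z.2 ∈ Y) ∧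
      (∀ z ∈ S, ∀ w ∈ S, levelCell r s N n z = levelCell r s N n w → z = w) ∧
      (∀ z ∈ S, ∀ w ∈ S, ∀ k < n, levelCell r s N k z = levelCell r s N k w →
        levelCell r s N (k + 1) z ≠ levelCell r s N (k + 1) w →
        ((2 * s + 4 : ℕ) : ℤ) ≤
          |levelLabel r s N (σ * t) k z - levelLabel r s N (σ * t) k w|) ∧
      n * (γ' * (N * Real.log r)) ≤ Real.log S.card := by
  classical
  have hr0 : 0 < r := by omega
  have hs0 : 0 < s := by omega
  have hlr : 0 < Real.log r := Real.log_pos (by exact_mod_cast hr)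
  have hls : 0 < Real.log s := Real.log_pos (by exact_mod_cast hs)
  set a := Real.log (cellFinset r X 1).card with ha
  set b := Real.log (cellFinset s Y 1).card with hb
  set q : ℕ → ℕ := fun k => matchLevel r s (N * k) with hq
  set e : ℕ → ℕ := fun l => matchLevel r s l with he
  obtain ⟨P, hPX, hPcard, hPinj⟩ := hX.exists_cell_representatives hr0 (N * n)
  obtain ⟨Q, hQY, hQcard, hQinj⟩ := hY.exists_cell_representatives hs0 (q n)
  have pP : 0 < P.card := hPcard ▸ hX.cellFinset_card_pos hr0 hXne _
  have pQ : 0 < Q.card := hQcard ▸ hY.cellFinset_card_pos hs0 hYne _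
  set A := P ×ˢ Q with hA
  have hAcard : (A.card : ℝ) = P.card * Q.card := by
    rw [hA, Finset.card_product, Nat.cast_mul]
  have hAne : A.Nonempty :=
    Finset.Nonempty.product (Finset.card_pos.1 pP) (Finset.card_pos.1 pQ)
  have hApos : (0 : ℝ) < A.card := Nat.cast_pos.2 (Finset.card_pos.2 hAne)
  set m := r ^ N with hm
  have hm0 : 0 < m := pow_pos hr0 N
  set τ : ℕ → ℝ := fun i => 1 + (i : ℝ) / m with hτ
  set h : ℕ → ℕ → ℝ × ℝ → ℝ := fun i k z =>
    Real.log (fiberAt A (levelCell r s N k) z).card -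
      Real.log (fiberAt A (fun w => (levelCell r s N k w,
        levelLabel r s N (σ * τ i) k w)) z).card with hh
  set dx : ℕ → ℕ → ℝ → ℝ := fun k l x =>
    deficit P (digitCell r (N * k)) (digitCell r (N * k + l)) (l * a) x with hdx
  set dy : ℕ → ℕ → ℝ → ℝ := fun k l y =>
    deficit Q (digitCell s (q k)) (digitCell s (q k + e l)) (e l * b) y with hdy
  set c₀ := γ * (N * Real.log r) - Real.log s - Real.log (33 * s * r * (N + 1)) with hc₀
  have hen : ∀ k, ∀ z ∈ A, (m : ℝ) * (c₀ - ∑ l ∈ Finset.range (N + 1), dx k l z.1 -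
      ∑ l ∈ Finset.range (N + 1), dy k l z.2) ≤ ∑ i ∈ Finset.range m, h i k z := by
    intro k z hz
    have h1 := sum_directions_entropy_ge (N := N) (e := e) hr hs
      (pow_matchLevel_le (s := s) hr0 (N * k))
      (le_pow_matchLevel_succ hs (N * k + N)) (matchLevel_zero r s)
      (fun l => pow_matchLevel_le hr0 l)
      (fun l => le_pow_matchLevel_succ hs l) hσ hz (a := a) (b := b) (α := α) hβ hβ1
      (by simpa using hα_le 1) (by simpa using hβ_le 1) hγ1 hγ
    refine le_trans (le_of_eq ?_) h1
    rw [hm, hc₀]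
    push_cast
    simp only [hdx, hdy, hq]
    ring
  have hDx : ∀ l ∈ Finset.range (N + 1), ∑ k ∈ Finset.range n, ∑ x ∈ P, dx k l x ≤
      P.card * (n * (N * (ε * Real.log r) + 3)) := by
    intro l hl
    have hlN : l ≤ N := Nat.lt_succ_iff.1 (Finset.mem_range.1 hl)
    refine (hX.sum_deficit_le hXne hr0 hPX (q := fun k => N * k) (e := l) (n := n) (by simp)
      (fun k => ?_) hPinj).trans ?_
    · rw [Nat.mul_succ]; omega
    refine mul_le_mul_of_nonneg_left ?_ (Nat.cast_nonneg _)
    -- P has a point in every cell, so its entropy is at least α N n log r, while the branching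
    -- allows at most (α + ε) N n log r. Only the ε term and 3 per level remain.
    have h1 := hα_le (N * n)
    rw [← hPcard] at h1
    have h2 := mul_le_mul_of_nonneg_left hα_ge (Nat.cast_nonneg (N * n))
    push_cast at h1 h2 ⊢
    linarith
  have hqn : (q n : ℝ) * Real.log s ≤ N * n * Real.log r := by
    have h1 : ((s : ℝ) ^ q n) ≤ (r : ℝ) ^ (N * n) := by
      exact_mod_cast pow_matchLevel_le (s := s) hr0 (N * n)
    have h2 := Real.log_le_log (by positivity) h1
    rw [Real.log_pow, Real.log_pow] at h2
    exact_mod_cast h2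
  have hDy : ∀ l ∈ Finset.range (N + 1), ∑ k ∈ Finset.range n, ∑ y ∈ Q, dy k l y ≤
      Q.card * (n * (N * (ε * Real.log r) + 3)) := by
    intro l hl
    have hlN : l ≤ N := Nat.lt_succ_iff.1 (Finset.mem_range.1 hl)
    refine (hY.sum_deficit_le hYne hs0 hQY (q := q) (e := e l) (n := n)
      (by simp [hq, matchLevel_zero]) (fun k => ?_) hQinj).trans ?_
    -- Rounding down is superadditive: the powers of s fit below r^(Nk) and r^l separately, hence
    -- their product below r^(N(k+1)).
    · refine le_matchLevel hr0 hs ?_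
      rw [pow_add, Nat.mul_succ, pow_add]
      exact Nat.mul_le_mul (pow_matchLevel_le hr0 _)
        ((pow_matchLevel_le hr0 l).trans (Nat.pow_le_pow_right hr0 hlN))
    refine mul_le_mul_of_nonneg_left ?_ (Nat.cast_nonneg _)
    have h1 := hβ_le (q n)
    rw [← hQcard] at h1
    have h2 := mul_le_mul_of_nonneg_left hβ_ge (Nat.cast_nonneg (q n))
    have h3 := mul_le_mul_of_nonneg_left hqn hε
    linarith
  set D := n * (N * (ε * Real.log r) + 3) with hD
  have hsumx : ∑ z ∈ A, ∑ k ∈ Finset.range n, ∑ l ∈ Finset.range (N + 1), dx k l z.1 ≤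
      A.card * ((N + 1) * D) := by
    rw [hA, Finset.sum_product_right]
    simp only
    rw [Finset.sum_const, nsmul_eq_mul, ← hA, hAcard]
    have : ∑ x ∈ P, ∑ k ∈ Finset.range n, ∑ l ∈ Finset.range (N + 1), dx k l x ≤
        ∑ l ∈ Finset.range (N + 1), P.card * D := by
      refine le_trans (le_of_eq ?_) (Finset.sum_le_sum hDx)
      rw [Finset.sum_comm]
      simp_rw [Finset.sum_comm (s := P)]
      rw [Finset.sum_comm]
    rw [Finset.sum_const, Finset.card_range, nsmul_eq_mul] at this
    push_cast at this
    have := mul_le_mul_of_nonneg_left this (Nat.cast_nonneg Q.card)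
    linarith
  have hsumy : ∑ z ∈ A, ∑ k ∈ Finset.range n, ∑ l ∈ Finset.range (N + 1), dy k l z.2 ≤
      A.card * ((N + 1) * D) := by
    rw [hA, Finset.sum_product]
    simp only
    rw [Finset.sum_const, nsmul_eq_mul, ← hA, hAcard]
    have : ∑ y ∈ Q, ∑ k ∈ Finset.range n, ∑ l ∈ Finset.range (N + 1), dy k l y ≤
        ∑ l ∈ Finset.range (N + 1), Q.card * D := by
      refine le_trans (le_of_eq ?_) (Finset.sum_le_sum hDy)
      rw [Finset.sum_comm]
      simp_rw [Finset.sum_comm (s := Q)]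
      rw [Finset.sum_comm]
    rw [Finset.sum_const, Finset.card_range, nsmul_eq_mul] at this
    push_cast at this
    have := mul_le_mul_of_nonneg_left this (Nat.cast_nonneg P.card)
    linarith
  have htotal : ∑ i ∈ Finset.range m, (A.card * (n * c₀ - 2 * ((N + 1) * D)) : ℝ) ≤
      ∑ i ∈ Finset.range m, ∑ z ∈ A, ∑ k ∈ Finset.range n, h i k z := by
    rw [Finset.sum_const, Finset.card_range, nsmul_eq_mul, Finset.sum_comm]
    have h1 : ∀ z ∈ A, ∑ k ∈ Finset.range n, (m : ℝ) * (c₀ -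
        ∑ l ∈ Finset.range (N + 1), dx k l z.1 - ∑ l ∈ Finset.range (N + 1), dy k l z.2) ≤
        ∑ i ∈ Finset.range m, ∑ k ∈ Finset.range n, h i k z := fun z hz => by
      rw [Finset.sum_comm]
      exact Finset.sum_le_sum fun k _ => hen k z hz
    refine le_trans ?_ (Finset.sum_le_sum h1)
    simp_rw [← Finset.mul_sum, Finset.sum_sub_distrib]
    refine mul_le_mul_of_nonneg_left ?_ (Nat.cast_nonneg _)
    simp only [Finset.sum_const, Finset.card_range, nsmul_eq_mul]
    linarith
  -- Some direction does at least as well as the average, for the sum over all levels at once; the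
  -- same direction thus serves every level.
  obtain ⟨i, hi, hige⟩ := Finset.exists_le_of_sum_le
    (Finset.nonempty_range_iff.2 hm0.ne') htotal
  -- The gap 2s + 4 exceeds the error 2 + 2s of the labels by 2: one unit will remain after
  -- perturbing the direction.
  obtain ⟨S, hSA, hSne, hSsep, hSsum⟩ := exists_separated_subset (g := 2 * s + 4) (by omega)
    (levelCell r s N) (levelLabel r s N (σ * τ i))
    (fun k z w => levelCell_eq_of_le hr0 hs0 (Nat.le_succ k))
    (fun k z w => levelLabel_eq) n 0 A hAne (fun z hz w hw => by
      have : ∀ z ∈ A, levelCell r s N 0 z = (0, 0) := by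
        intro z hz
        obtain ⟨h1, h2⟩ := Finset.mem_product.1 hz
        have h3 := Finset.mem_Ico.1 (digitCell_mem_Ico hr0 0 (hX.subset_Ico (hPX _ h1)))
        have h4 := Finset.mem_Ico.1 (digitCell_mem_Ico hs0 0 (hY.subset_Ico (hQY _ h2)))
        rw [pow_zero] at h3 h4
        simp only [levelCell, pairCell, mul_zero, matchLevel_zero, Prod.mk.injEq]
        constructor <;> omega
      rw [this z hz, this w hw])
  have him : (i : ℝ) / m ≤ 1 := by
    rw [div_le_one (by exact_mod_cast hm0)]
    exact_mod_cast (Finset.mem_range.1 hi).le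
  have him0 : (0 : ℝ) ≤ (i : ℝ) / m := by positivity
  refine ⟨τ i, ⟨by simp only [hτ]; linarith, by simp only [hτ]; linarith⟩, S, hSne,
    fun z hz => ?_, fun z hz w hw hzw => ?_, fun z hz w hw k hk => ?_, ?_⟩
  · obtain ⟨h1, h2⟩ := Finset.mem_product.1 (hSA hz)
    exact ⟨hPX _ h1, hQY _ h2⟩
  · obtain ⟨h1, h2⟩ := Finset.mem_product.1 (hSA hz)
    obtain ⟨h3, h4⟩ := Finset.mem_product.1 (hSA hw)
    simp only [levelCell, pairCell, Prod.mk.injEq] at hzw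
    exact Prod.ext (hPinj _ h1 _ h3 hzw.1) (hQinj _ h2 _ h4 hzw.2)
  · exact hSsep z hz w hw k (Nat.zero_le k) (by omega)
  · simp only [zero_add] at hSsum
    have h1 := le_of_mul_le_mul_left (hige.trans hSsum) hApos
    have h2 := mul_le_mul_of_nonneg_left hpar (Nat.cast_nonneg n)
    rw [hD] at h1
    rw [hc₀] at h1
    linarith

end Frostman

/-! ### Magnifying a cell; stability under a change of direction. -/

section FrostmanCell

theorem fract_pow_sub_of_digitCell_eq {r j : ℕ} {x y : ℝ}
    (h : digitCell r j x = digitCell r j y) :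
    Int.fract ((r : ℝ) ^ j * x) - Int.fract ((r : ℝ) ^ j * y) = (r : ℝ) ^ j * (x - y) := by
  unfold digitCell at h
  rw [Int.fract, Int.fract, h]
  ring

theorem digitCell_mem_Ico_of_fiber {r : ℕ} (hr : 0 < r) (j l : ℕ) {x y : ℝ}
    (h : digitCell r j y = digitCell r j x) : digitCell r (j + l) y ∈
      Finset.Ico ((r : ℤ) ^ l * digitCell r j x) ((r : ℤ) ^ l * digitCell r j x + (r : ℤ) ^ l) := by
  have := Finset.mem_Ico.1 (digitCell_mem_Ico hr l
    (x := Int.fract ((r : ℝ) ^ j * y)) ⟨Int.fract_nonneg _, Int.fract_lt_one _⟩)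
  rw [digitCell_add, h, Finset.mem_Ico]
  constructor <;> linarith

/-- The number of points in a cell of level `j`, if they lie in different cells of level `n`. -/
theorem card_fiberAt_levelCell_le {r s N : ℕ} (hr : 0 < r) (hs : 1 < s) {j n : ℕ} (hjn : j ≤ n)
    {S : Finset (ℝ × ℝ)}
    (hinj : ∀ z ∈ S, ∀ w ∈ S, levelCell r s N n z = levelCell r s N n w → z = w) (z : ℝ × ℝ) :
    (fiberAt S (levelCell r s N j) z).card ≤ r ^ (N * (n - j)) * (r ^ (N * (n - j)) * s) := by
  have hs0 : 0 < s := by omega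
  set d := N * (n - j) with hd
  have hNn : N * n = N * j + d := by rw [hd, ← Nat.mul_add]; congr 1; omega
  obtain ⟨d', hd'⟩ := Nat.exists_eq_add_of_le
    (matchLevel_mono (s := s) hr (Nat.mul_le_mul_left N hjn))
  have h1 : (fiberAt S (levelCell r s N j) z).card ≤
      ((Finset.Ico ((r : ℤ) ^ d * digitCell r (N * j) z.1)
          ((r : ℤ) ^ d * digitCell r (N * j) z.1 + (r : ℤ) ^ d)) ×ˢ
        (Finset.Ico ((s : ℤ) ^ d' * digitCell s (matchLevel r s (N * j)) z.2)
          ((s : ℤ) ^ d' * digitCell s (matchLevel r s (N * j)) z.2 + (s : ℤ) ^ d'))).card := by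
    refine Finset.card_le_card_of_injOn (levelCell r s N n) (fun w hw => ?_)
      (fun w hw w' hw' h => hinj w (mem_fiberAt.1 hw).1 w' (mem_fiberAt.1 hw').1 h)
    have := (mem_fiberAt.1 hw).2
    simp only [levelCell, pairCell, Prod.mk.injEq] at this
    simp only [levelCell, pairCell, Finset.mem_coe, Finset.mem_product]
    rw [hNn] at hd' ⊢
    rw [hd']
    exact ⟨digitCell_mem_Ico_of_fiber hr _ _ this.1, digitCell_mem_Ico_of_fiber hs0 _ _ this.2⟩
  rw [Finset.card_product, Int.card_Ico, Int.card_Ico, add_sub_cancel_left, add_sub_cancel_left]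
    at h1
  have e1 : ((r : ℤ) ^ d).toNat = r ^ d := by exact_mod_cast Int.toNat_natCast (r ^ d)
  have e2 : ((s : ℤ) ^ d').toNat = s ^ d' := by exact_mod_cast Int.toNat_natCast (s ^ d')
  rw [e1, e2] at h1
  refine h1.trans (Nat.mul_le_mul_left _ ?_)
  have h2 : s ^ matchLevel r s (N * n) ≤ r ^ (N * n) := pow_matchLevel_le hr _
  have h3 : r ^ (N * j) ≤ s ^ (matchLevel r s (N * j) + 1) := le_pow_matchLevel_succ hs _
  rw [hd', hNn, pow_add, pow_add] at h2
  rw [pow_succ] at h3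
  have hpos : 0 < s ^ matchLevel r s (N * j) := pow_pos hs0 _
  refine Nat.le_of_mul_le_mul_left (h2.trans ?_) hpos
  calc r ^ (N * j) * r ^ d ≤ s ^ matchLevel r s (N * j) * s * r ^ d := Nat.mul_le_mul_right _ h3
    _ = _ := by ring

/-- Points of a cell of level `j` that are separated when they split have well-separated
projections in all nearby directions. -/
theorem levelCell_eq_of_proj_close {r s N : ℕ} (hr : 1 < r) (hs : 1 < s) {σ : ℝ} (hσ : |σ| = 1)
    {t : ℝ} (ht : t ∈ Icc (1 : ℝ) 2) {j i : ℕ} {z w : ℝ × ℝ}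
    (hsep : ∀ k < j + i, levelCell r s N k z = levelCell r s N k w →
        levelCell r s N (k + 1) z ≠ levelCell r s N (k + 1) w →
        ((2 * s + 4 : ℕ) : ℤ) ≤
          |levelLabel r s N (σ * t) k z - levelLabel r s N (σ * t) k w|)
    (hj : levelCell r s N j z = levelCell r s N j w) {t' : ℝ}
    (ht' : |t' - t * ((r : ℝ) ^ (N * j) / (s : ℝ) ^ matchLevel r s (N * j))| ≤
      ((r : ℝ) ^ N)⁻¹ / s)
    (hclose : |(Int.fract ((r : ℝ) ^ (N * j) * z.1) +
        σ * t' * Int.fract ((s : ℝ) ^ matchLevel r s (N * j) * z.2)) -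
      (Int.fract ((r : ℝ) ^ (N * j) * w.1) +
        σ * t' * Int.fract ((s : ℝ) ^ matchLevel r s (N * j) * w.2))| < (((r : ℝ) ^ N)⁻¹) ^ i) :
    levelCell r s N (j + i) z = levelCell r s N (j + i) w := by
  have hr0 : 0 < r := by omega
  have hs0 : 0 < s := by omega
  have hrR : (0 : ℝ) < r := Nat.cast_pos.2 hr0
  have hsR : (0 : ℝ) < s := Nat.cast_pos.2 hs0
  set q := matchLevel r s (N * j) with hq
  have hj' := hj
  simp only [levelCell, pairCell, Prod.mk.injEq] at hj'
  set R := (r : ℝ) ^ (N * j) with hR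
  have hRpos : 0 < R := pow_pos hrR _
  have hsq : (0 : ℝ) < (s : ℝ) ^ q := pow_pos hsR _
  set D := z.1 - w.1 + σ * t * (z.2 - w.2) with hD
  have hΔ : (Int.fract (R * z.1) + σ * t' * Int.fract ((s : ℝ) ^ q * z.2)) -
      (Int.fract (R * w.1) + σ * t' * Int.fract ((s : ℝ) ^ q * w.2)) =
      R * D + σ * ((t' - t * (R / (s : ℝ) ^ q)) * ((s : ℝ) ^ q * (z.2 - w.2))) := by
    have h1 := fract_pow_sub_of_digitCell_eq hj'.1
    have h2 := fract_pow_sub_of_digitCell_eq hj'.2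
    rw [← hR] at h1
    rw [← hq] at h2
    have h3 : σ * ((t' - t * (R / (s : ℝ) ^ q)) * ((s : ℝ) ^ q * (z.2 - w.2))) =
        σ * t' * ((s : ℝ) ^ q * (z.2 - w.2)) - σ * t * R * (z.2 - w.2) := by
      field_simp
    rw [h3, ← h2, hD]
    linear_combination h1
  rw [hΔ] at hclose
  have hρ1 : ((r : ℝ) ^ N)⁻¹ ≤ 1 := inv_le_one_of_one_le₀ (one_le_pow₀ (by exact_mod_cast hr.le))
  -- At a first splitting level k + 1, the separated labels force a magnified gap of at least
  -- 2ρ^(i'+1), with ρ = r^(-N). Changing the direction by ρ / s moves it by at most ρ^(i'+1),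
  -- because the points still share a cell of level k. What remains is at least ρ^i, against
  -- `hclose`.
  have hstep : ∀ i' ≤ i, levelCell r s N (j + i') z = levelCell r s N (j + i') w := by
    intro i'
    induction i' with
    | zero => exact fun _ => hj
    | succ i' ih =>
      intro hi'
      have hk := ih (by omega)
      by_contra hne
      set k := j + i' with hkdef
      have hlab := hsep k (by omega) hk hne
      have habs : |σ * t| ≤ 2 := by
        rw [abs_mul, hσ, one_mul, abs_of_nonneg (by linarith [ht.1])]; exact ht.2
      have h1 := le_abs_proj_of_projLabel hr0 hs0 habs
        (by exact_mod_cast le_pow_matchLevel_succ (r := r) hs (N * k + N)) hlab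
      rw [← hD] at h1
      push_cast at h1
      have h2 : (2 * (s : ℝ) + 4 - 2 - 2 * s) = 2 := by ring
      rw [h2] at h1
      have hk' := hk
      simp only [levelCell, pairCell, Prod.mk.injEq] at hk'
      have h3 := abs_sub_lt_of_digitCell_eq hs0 hk'.2
      set q' := matchLevel r s (N * k) with hq'
      have hsq' : (0 : ℝ) < (s : ℝ) ^ q' := pow_pos hsR _
      have hrk : (0 : ℝ) < (r : ℝ) ^ (N * k) := pow_pos hrR _
      have h4 : ((s : ℝ) ^ q')⁻¹ ≤ s / (r : ℝ) ^ (N * k) := by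
        have : (r : ℝ) ^ (N * k) ≤ (s : ℝ) ^ (q' + 1) := by
          exact_mod_cast le_pow_matchLevel_succ (r := r) hs (N * k)
        rw [← one_div, div_le_div_iff₀ hsq' hrk, one_mul, ← pow_succ']
        exact this
      have h5 : (s : ℝ) ^ q ≤ R := by
        rw [hR]; exact_mod_cast pow_matchLevel_le (s := s) hr0 (N * j)
      have h6 : |σ * ((t' - t * (R / (s : ℝ) ^ q)) * ((s : ℝ) ^ q * (z.2 - w.2)))| ≤
          R / ((r : ℝ) ^ (N * k) * (r : ℝ) ^ N) := by
        rw [abs_mul, hσ, one_mul, abs_mul, abs_mul, abs_of_pos hsq]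
        calc _ ≤ (((r : ℝ) ^ N)⁻¹ / s) * (R * (s / (r : ℝ) ^ (N * k))) := by
              refine mul_le_mul ht' (mul_le_mul h5 (h3.le.trans h4) (abs_nonneg _) hRpos.le)
                (by positivity) (by positivity)
          _ = _ := by field_simp
      have h7 : R * (2 / (r : ℝ) ^ (N * k + N)) ≤ |R * D| := by
        rw [abs_mul, abs_of_pos hRpos]
        exact mul_le_mul_of_nonneg_left h1 hRpos.le
      have h8 : R * (2 / (r : ℝ) ^ (N * k + N)) = 2 * (R / ((r : ℝ) ^ (N * k) * (r : ℝ) ^ N)) := by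
        rw [pow_add]; ring
      have h9 : R / ((r : ℝ) ^ (N * k) * (r : ℝ) ^ N) = (((r : ℝ) ^ N)⁻¹) ^ (i' + 1) := by
        rw [hR, hkdef, Nat.mul_add, pow_add, pow_succ, inv_pow, ← pow_mul]
        field_simp
      have h10 : (((r : ℝ) ^ N)⁻¹) ^ i ≤ (((r : ℝ) ^ N)⁻¹) ^ (i' + 1) :=
        pow_le_pow_of_le_one (by positivity) hρ1 hi'
      have h11 := abs_sub_abs_le_abs_add (R * D)
        (σ * ((t' - t * (R / (s : ℝ) ^ q)) * ((s : ℝ) ^ q * (z.2 - w.2))))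
      rw [h8, h9] at h7
      rw [h9] at h6
      linarith
  exact hstep i le_rfl

/-- Arbitrarily deep in the product there are finite sets of points with uniformly Frostman
projections in all directions close to some direction. -/
theorem exists_frostman_points {r s N : ℕ} (hr : 1 < r) (hs : 1 < s) (hN : 0 < N)
    {X Y : Set ℝ} {σ : ℝ} (hσ : |σ| = 1) {γ γ' : ℝ} (hγ0 : 0 ≤ γ) (hγγ' : γ < γ')
    (hsep : ∀ n : ℕ, ∃ t ∈ Icc (1 : ℝ) 2, ∃ S : Finset (ℝ × ℝ), S.Nonempty ∧
      (∀ z ∈ S, z.1 ∈ X ∧ z.2 ∈ Y) ∧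
      (∀ z ∈ S, ∀ w ∈ S, levelCell r s N n z = levelCell r s N n w → z = w) ∧
      (∀ z ∈ S, ∀ w ∈ S, ∀ k < n, levelCell r s N k z = levelCell r s N k w →
        levelCell r s N (k + 1) z ≠ levelCell r s N (k + 1) w →
        ((2 * s + 4 : ℕ) : ℤ) ≤
          |levelLabel r s N (σ * t) k z - levelLabel r s N (σ * t) k w|) ∧
      n * (γ' * (N * Real.log r)) ≤ Real.log S.card) (hX : X ⊆ Ico 0 1) (hY : Y ⊆ Ico 0 1)
    (m j₀ : ℕ) :
    ∃ t ∈ Icc (1 : ℝ) (2 * s), ∃ S : Finset (ℝ × ℝ), S.Nonempty ∧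
      (∀ z ∈ S, z.1 ∈ X ∧ z.2 ∈ Y) ∧ ∃ p q : ℕ, j₀ ≤ p ∧ j₀ ≤ q ∧
      ∀ t', |t' - t| ≤ ((r : ℝ) ^ N)⁻¹ / s → ∀ i ≤ m, ∀ c : ℝ,
        ((S.filter fun z => |Int.fract ((r : ℝ) ^ p * z.1) +
          σ * t' * Int.fract ((s : ℝ) ^ q * z.2) - c| < (((r : ℝ) ^ N)⁻¹) ^ i / 2).card : ℝ) ≤
        ((((r : ℝ) ^ N)⁻¹) ^ i) ^ γ * S.card := by
  have hr0 : 0 < r := by omega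
  have hs0 : 0 < s := by omega
  have hrR : (0 : ℝ) < r := Nat.cast_pos.2 hr0
  have hsR : (0 : ℝ) < s := Nat.cast_pos.2 hs0
  have hlr : 0 < Real.log r := Real.log_pos (by exact_mod_cast hr)
  have hNR : (0 : ℝ) < N := Nat.cast_pos.2 hN
  set v := Real.exp (γ * (N * Real.log r)) with hv
  have hv1 : 1 ≤ v := Real.one_le_exp (by positivity)
  -- Since s ≤ r^s, level s j₀ in base r is at least level j₀ in base s.
  set j₁ := s * j₀ with hj₁
  set C : ℝ := (r : ℝ) ^ (N * j₁) * (s : ℝ) ^ matchLevel r s (N * j₁) with hC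
  have hC0 : 0 < C := by positivity
  set C' : ℝ := (r : ℝ) ^ (N * m) * ((r : ℝ) ^ (N * m) * s) with hC'
  have hC'0 : 0 < C' := by positivity
  have hδ : 0 < (γ' - γ) * (N * Real.log r) := mul_pos (by linarith) (by positivity)
  obtain ⟨n₀, hn₀⟩ := exists_nat_gt (Real.log (C * C') / ((γ' - γ) * (N * Real.log r)))
  rw [div_lt_iff₀ hδ] at hn₀
  set n := max n₀ j₁ with hn
  have hn₀n : (n₀ : ℝ) ≤ n := by exact_mod_cast le_max_left n₀ j₁
  have hnbig : Real.log (C * C') < n * ((γ' - γ) * (N * Real.log r)) :=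
    hn₀.trans_le (mul_le_mul_of_nonneg_right hn₀n hδ.le)
  obtain ⟨t, ht, S, hSne, hSXY, hSinj, hSsep, hScard⟩ := hsep n
  have hcells : ((S.image (levelCell r s N j₁)).card : ℝ) ≤ C := by
    have : S.image (levelCell r s N j₁) ⊆ (Finset.Ico (0 : ℤ) ((r : ℤ) ^ (N * j₁))) ×ˢ
        (Finset.Ico (0 : ℤ) ((s : ℤ) ^ matchLevel r s (N * j₁))) := by
      intro c hc
      obtain ⟨z, hz, rfl⟩ := Finset.mem_image.1 hc
      exact Finset.mem_product.2 ⟨digitCell_mem_Ico hr0 _ (hX (hSXY z hz).1),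
        digitCell_mem_Ico hs0 _ (hY (hSXY z hz).2)⟩
    have h1 := Finset.card_le_card this
    have e1 : ((r : ℤ) ^ (N * j₁)).toNat = r ^ (N * j₁) := by
      exact_mod_cast Int.toNat_natCast (r ^ (N * j₁))
    have e2 : ((s : ℤ) ^ matchLevel r s (N * j₁)).toNat = s ^ matchLevel r s (N * j₁) := by
      exact_mod_cast Int.toNat_natCast (s ^ matchLevel r s (N * j₁))
    rw [Finset.card_product, Int.card_Ico, Int.card_Ico, sub_zero, sub_zero, e1, e2] at h1
    rw [hC]
    exact_mod_cast h1
  obtain ⟨j, hj1, hjn, z₀, hz₀, hfr, hbig⟩ := exists_cell_card_mul_pow_le S hSne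
    (levelCell r s N) hv1 (le_max_right n₀ j₁) hcells
  have hSpos : (0 : ℝ) < S.card := Nat.cast_pos.2 (Finset.card_pos.2 hSne)
  -- Fewer than m remaining levels would bound the cell by C', hence S by C C' v^n; this contradicts
  -- the growth rate γ' > γ for the chosen n.
  have hjm : j + m ≤ n := by
    by_contra hcon
    push Not at hcon
    have h1 : ((fiberAt S (levelCell r s N j) z₀).card : ℝ) ≤ C' := by
      have h2 : (fiberAt S (levelCell r s N j) z₀).card ≤
          r ^ (N * m) * (r ^ (N * m) * s) := by
        refine (card_fiberAt_levelCell_le hr0 hs hjn hSinj z₀).trans ?_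
        have : r ^ (N * (n - j)) ≤ r ^ (N * m) :=
          Nat.pow_le_pow_right hr0 (Nat.mul_le_mul_left N (by omega))
        exact Nat.mul_le_mul this (Nat.mul_le_mul_right s this)
      rw [hC']
      exact_mod_cast h2
    have h3 : (S.card : ℝ) ≤ C * C' * v ^ n := by
      refine hbig.trans ?_
      rw [mul_assoc C C']
      exact mul_le_mul_of_nonneg_left (mul_le_mul h1 (pow_le_pow_right₀ hv1 hjn)
        (by positivity) hC'0.le) hC0.le
    have h4 := Real.log_le_log hSpos h3
    rw [Real.log_mul (by positivity) (by positivity), Real.log_pow, hv, Real.log_exp] at h4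
    linarith
  set q := matchLevel r s (N * j) with hq
  set R := (r : ℝ) ^ (N * j) with hR
  have hsq : (0 : ℝ) < (s : ℝ) ^ q := pow_pos hsR _
  have hc1 : 1 ≤ R / (s : ℝ) ^ q := by
    rw [one_le_div hsq, hR]; exact_mod_cast pow_matchLevel_le (s := s) hr0 (N * j)
  have hcs : R / (s : ℝ) ^ q ≤ s := by
    rw [div_le_iff₀ hsq, ← pow_succ', hR]
    exact_mod_cast le_pow_matchLevel_succ (r := r) hs (N * j)
  have hj₀ : j₀ ≤ N * j := by
    calc j₀ ≤ s * j₀ := Nat.le_mul_of_pos_left _ hs0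
      _ ≤ j := hj1
      _ ≤ N * j := Nat.le_mul_of_pos_left _ hN
  have hj₀q : j₀ ≤ q := by
    refine le_matchLevel hr0 hs ?_
    calc s ^ j₀ ≤ (r ^ s) ^ j₀ := Nat.pow_le_pow_left (Nat.lt_pow_self hr).le _
      _ = r ^ j₁ := by rw [← pow_mul]
      _ ≤ r ^ (N * j) := Nat.pow_le_pow_right hr0 (hj1.trans (Nat.le_mul_of_pos_left _ hN))
  -- Magnifying the coordinates by R and s^q multiplies the slope by R / s^q, which lies between 1
  -- and s.
  refine ⟨t * (R / (s : ℝ) ^ q), ⟨?_, ?_⟩, fiberAt S (levelCell r s N j) z₀,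
    ⟨z₀, self_mem_fiberAt hz₀⟩, fun z hz => hSXY z (mem_fiberAt.1 hz).1, N * j, q, hj₀, hj₀q, ?_⟩
  · nlinarith [ht.1]
  · exact mul_le_mul ht.2 hcs (by linarith) (by norm_num)
  intro t' ht' i hi c
  set ρ := ((r : ℝ) ^ N)⁻¹ with hρ
  have hρpos : 0 < ρ := by positivity
  have hρv : (ρ ^ i) ^ γ = (v ^ i)⁻¹ := by
    rw [Real.rpow_def_of_pos (pow_pos hρpos i), Real.log_pow, hρ, Real.log_inv, Real.log_pow,
      hv, ← Real.exp_nat_mul, ← Real.exp_neg]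
    congr 1
    ring
  rw [hρv, ← div_eq_inv_mul, le_div_iff₀ (by positivity)]
  set T := (fiberAt S (levelCell r s N j) z₀).filter fun z => |Int.fract (R * z.1) +
          σ * t' * Int.fract ((s : ℝ) ^ q * z.2) - c| < ρ ^ i / 2 with hT
  rcases T.eq_empty_or_nonempty with hTe | ⟨z₁, hz₁⟩
  · rw [hTe, Finset.card_empty, Nat.cast_zero, zero_mul]; positivity
  obtain ⟨hz₁m, hz₁c⟩ := Finset.mem_filter.1 hz₁
  obtain ⟨hz₁S, hz₁cell⟩ := mem_fiberAt.1 hz₁m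
  have hsub : T ⊆ fiberAt S (levelCell r s N (j + i)) z₁ := by
    intro z hz
    obtain ⟨hzm, hzc⟩ := Finset.mem_filter.1 hz
    obtain ⟨hzS, hzcell⟩ := mem_fiberAt.1 hzm
    refine mem_fiberAt.2 ⟨hzS, ?_⟩
    refine levelCell_eq_of_proj_close hr hs hσ ht
      (fun k hk => hSsep z hzS z₁ hz₁S k (by omega)) (hzcell.trans hz₁cell.symm) ht' ?_
    have := abs_sub_lt_iff.1 hzc
    have := abs_sub_lt_iff.1 hz₁c
    rw [abs_sub_lt_iff]
    constructor <;> linarith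
  refine le_trans ?_ (hfr i (by omega) z₁ hz₁S)
  exact mul_le_mul_of_nonneg_right (Nat.cast_le.2 (Finset.card_le_card hsub)) (by positivity)

end FrostmanCell

/-! ### Density of r^n / s^m from multiplicative independence. -/

section Density

/-- If `a / b` is irrational, the differences `n a - m b` with natural `n`, `m` are dense. -/
theorem exists_nat_mul_sub_nat_mul_near {a b : ℝ} (ha : 0 < a) (hb : 0 < b)
    (hab : Irrational (a / b)) (u : ℝ) {ε : ℝ} (hε : 0 < ε) :
    ∃ n m : ℕ, |n * a - m * b - u| < ε := by
  have : Fact (0 < b) := ⟨hb⟩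
  -- Starting from n₀ a > u + ε forces the integer multiple of b to be negative, so that m is a
  -- natural number.
  obtain ⟨n₀, hn₀⟩ := exists_nat_gt ((u + ε) / a)
  rw [div_lt_iff₀ ha] at hn₀
  have hd : DenseRange (· • (a : AddCircle b) : ℕ → AddCircle b) :=
    denseRange_zsmul_iff_nsmul.1 (AddCircle.denseRange_zsmul_coe_iff.2 hab)
  obtain ⟨n, hn⟩ := Metric.mem_closure_range_iff.1 (hd ((u - n₀ * a : ℝ) : AddCircle b)) ε hε
  rw [dist_eq_norm, ← AddCircle.coe_nsmul, ← AddCircle.coe_sub, AddCircle.norm_eq] at hn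
  set k := round (b⁻¹ * (u - n₀ * a - n • a))
  rw [nsmul_eq_mul] at hn
  have hk : (k : ℝ) * b < 0 := by
    have h1 := (abs_lt.1 hn).1
    have h2 : 0 ≤ (n : ℝ) * a := by positivity
    linarith
  have hk' : k < 0 := by
    by_contra hcon
    push Not at hcon
    have : (0 : ℝ) ≤ k := by exact_mod_cast hcon
    nlinarith
  obtain ⟨m, hm⟩ := Int.eq_ofNat_of_zero_le (show 0 ≤ -k by omega)
  refine ⟨n₀ + n, m, ?_⟩
  have hmk : (m : ℝ) = -k := by
    have : ((m : ℤ) : ℝ) = ((-k : ℤ) : ℝ) := by rw [hm]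
    simpa using this
  rw [abs_sub_comm, hmk]
  push_cast
  convert hn using 2
  ring

theorem exists_mul_pow_div_pow_mem {r s : ℕ} (hr : 1 < r) (hs : 1 < s)
    (hrs : Irrational (Real.log r / Real.log s)) {T t δ : ℝ} (hT : 0 < T) (ht : 0 < t)
    (hδ : 0 < δ) : ∃ n m : ℕ, T * ((r : ℝ) ^ n / (s : ℝ) ^ m) ∈ ball t δ := by
  have hlr : 0 < Real.log r := Real.log_pos (by exact_mod_cast hr)
  have hls : 0 < Real.log s := Real.log_pos (by exact_mod_cast hs)
  have hrR : (0 : ℝ) < r := by exact_mod_cast (by omega : 0 < r)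
  have hsR : (0 : ℝ) < s := by exact_mod_cast (by omega : 0 < s)
  have hcont : ContinuousAt (fun x => T * Real.exp x) (Real.log (t / T)) := by fun_prop
  obtain ⟨ε, hε, h⟩ := Metric.continuousAt_iff.1 hcont δ hδ
  obtain ⟨n, m, hnm⟩ := exists_nat_mul_sub_nat_mul_near hlr hls hrs (Real.log (t / T)) hε
  refine ⟨n, m, ?_⟩
  have h1 := h (x := n * Real.log r - m * Real.log s) (by rw [Real.dist_eq]; exact hnm)
  rw [Real.exp_log (div_pos ht hT), mul_div_cancel₀ _ hT.ne', Real.exp_sub, ← Real.log_pow,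
    ← Real.log_pow, Real.exp_log (pow_pos hrR n), Real.exp_log (pow_pos hsR m)] at h1
  exact h1

end Density

/-! ### Growth exponents by Fekete's lemma. -/

section Dimension

open Filter MeasureTheory Topology

/-- The growth exponent of the number of cells dominates the Hausdorff dimension. -/
theorem IsFractInvariant.exists_exponent {r : ℕ} (hr : 1 < r) {X : Set ℝ}
    (hX : IsFractInvariant r X) (hne : X.Nonempty) :
    ∃ α : ℝ, 0 ≤ α ∧ α ≤ 1 ∧ dimH X ≤ ENNReal.ofReal α ∧
      (∀ n : ℕ, α * (n * Real.log r) ≤ Real.log (cellFinset r X n).card) ∧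
      ∀ ε > 0, ∀ᶠ n : ℕ in atTop,
        Real.log (cellFinset r X n).card ≤ (α + ε) * (n * Real.log r) := by
  have hr0 : 0 < r := by omega
  have hrR : (0 : ℝ) < r := by exact_mod_cast hr0
  have hlr : 0 < Real.log r := Real.log_pos (by exact_mod_cast hr)
  set u : ℕ → ℝ := fun n => Real.log (cellFinset r X n).card with hu
  have hpos : ∀ n, (0 : ℝ) < (cellFinset r X n).card := fun n =>
    Nat.cast_pos.2 (hX.cellFinset_card_pos hr0 hne n)
  have hsub : Subadditive u := fun m n => by
    rw [hu]
    simp only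
    rw [← Real.log_mul (hpos m).ne' (hpos n).ne']
    exact Real.log_le_log (hpos _) (by exact_mod_cast hX.cellFinset_card_add_le hr0 m n)
  have hu0 : ∀ n, 0 ≤ u n := fun n =>
    Real.log_nonneg (by exact_mod_cast hX.cellFinset_card_pos hr0 hne n)
  have hbdd : BddBelow (range fun n => u n / n) :=
    ⟨0, by rintro _ ⟨n, rfl⟩; exact div_nonneg (hu0 n) (Nat.cast_nonneg n)⟩
  have htend := hsub.tendsto_lim hbdd
  have hlim0 : 0 ≤ hsub.lim :=
    ge_of_tendsto' htend fun n => div_nonneg (hu0 n) (Nat.cast_nonneg n)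
  set α := hsub.lim / Real.log r with hα
  have hα0 : 0 ≤ α := div_nonneg hlim0 hlr.le
  have hαr : α * Real.log r = hsub.lim := div_mul_cancel₀ _ hlr.ne'
  have hle : ∀ n : ℕ, α * (n * Real.log r) ≤ u n := by
    intro n
    rcases Nat.eq_zero_or_pos n with rfl | hn
    · simpa using hu0 0
    have := hsub.lim_le_div hbdd hn.ne'
    rw [le_div_iff₀ (Nat.cast_pos.2 hn), ← hαr] at this
    linarith
  have hge : ∀ ε > 0, ∀ᶠ n : ℕ in atTop, u n ≤ (α + ε) * (n * Real.log r) := by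
    intro ε hε
    have h1 : hsub.lim < (α + ε) * Real.log r := by
      rw [← hαr]; nlinarith
    filter_upwards [htend.eventually (gt_mem_nhds h1), eventually_gt_atTop 0] with n hn hn0
    rw [div_lt_iff₀ (Nat.cast_pos.2 hn0)] at hn
    linarith
  refine ⟨α, hα0, ?_, ?_, hle, hge⟩
  · have h1 := hle 1
    have h2 : u 1 ≤ Real.log r :=
      Real.log_le_log (hpos 1) (by exact_mod_cast (cellFinset_card_le r X 1).trans_eq (pow_one r))
    simp only [Nat.cast_one, one_mul] at h1
    exact le_of_mul_le_mul_right (by linarith) hlr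
  -- The cells of level n cover X, and their number times r^(-n(α+ε)) is eventually at most 1, so
  -- the Hausdorff measure of dimension α + ε is finite.
  · refine ENNReal.le_of_forall_pos_le_add fun ε hε _ => ?_
    set d : NNReal := α.toNNReal + ε with hd
    have hdR : (d : ℝ) = α + ε := by rw [hd]; simp [hα0]
    have hgoal : dimH X ≤ d := by
      refine dimH_le_of_hausdorffMeasure_ne_top ?_
      refine ne_top_of_le_ne_top ENNReal.one_ne_top ?_
      have hr1 : (r : ℝ)⁻¹ < 1 := inv_lt_one_of_one_lt₀ (by exact_mod_cast hr)
      have hdiam : Tendsto (fun n : ℕ => ENNReal.ofReal (((r : ℝ)⁻¹) ^ n)) atTop (𝓝 0) := by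
        rw [← ENNReal.ofReal_zero]
        exact (ENNReal.continuous_ofReal.tendsto 0).comp
          (tendsto_pow_atTop_nhds_zero_of_lt_one (by positivity) hr1)
      have hed : ∀ (n : ℕ) (c : cellFinset r X n),
          ediam {x : ℝ | digitCell r n x = c} ≤ ENNReal.ofReal (((r : ℝ)⁻¹) ^ n) := by
        intro n c
        refine Metric.ediam_le fun x hx y hy => ?_
        rw [edist_dist, Real.dist_eq]
        refine ENNReal.ofReal_le_ofReal ?_
        rw [inv_pow]
        exact (abs_sub_lt_of_digitCell_eq hr0 (hx.trans hy.symm)).le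
      refine (Measure.hausdorffMeasure_le_liminf_sum (ι := fun n => cellFinset r X n) d X
        _ hdiam (fun n c => {x : ℝ | digitCell r n x = c}) (Eventually.of_forall hed)
        (Eventually.of_forall fun n x hx => mem_iUnion.2
          ⟨⟨_, (hX.mem_cellFinset hr0).2 ⟨x, hx, rfl⟩⟩, rfl⟩)).trans ?_
      refine liminf_le_of_frequently_le (Eventually.frequently ?_)
      filter_upwards [hge ε hε] with n hn
      calc _ ≤ ∑ c : cellFinset r X n, ENNReal.ofReal (((r : ℝ)⁻¹) ^ n) ^ (d : ℝ) :=
            Finset.sum_le_sum fun c _ => ENNReal.rpow_le_rpow (hed n c) d.2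
        _ = ENNReal.ofReal ((cellFinset r X n).card * (((r : ℝ)⁻¹) ^ n) ^ (d : ℝ)) := by
            rw [Finset.sum_const, Finset.card_univ, Fintype.card_coe, nsmul_eq_mul,
              ENNReal.ofReal_mul (Nat.cast_nonneg _), ENNReal.ofReal_natCast,
              ENNReal.ofReal_rpow_of_pos (by positivity)]
        _ ≤ 1 := by
            rw [← ENNReal.ofReal_one]
            refine ENNReal.ofReal_le_ofReal ?_
            rw [← Real.exp_log (hpos n), Real.rpow_def_of_pos (by positivity), ← Real.exp_add,
              Real.exp_le_one_iff, Real.log_pow, Real.log_inv, hdR]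
            simp only [hu] at hn
            linarith
    refine hgoal.trans (le_of_eq ?_)
    rw [hd, ENNReal.coe_add]
    rfl

end Dimension

/-! ### Choice of parameters and an interval of good directions. -/

section Parameters

open Filter

/-- Frostman points for suitable powers of the bases, expressed in the original bases. -/
theorem exists_frostman_scale {r s : ℕ} (hr : 1 < r) (hs : 1 < s) {X Y : Set ℝ}
    (hX : IsFractInvariant r X) (hY : IsFractInvariant s Y) (hXne : X.Nonempty)
    (hYne : Y.Nonempty) {σ : ℝ} (hσ : |σ| = 1) {γ : ℝ} (hγ0 : 0 ≤ γ)
    (hγ : ENNReal.ofReal γ < min (dimH X + dimH Y) 1) :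
    ∃ ρ κ B : ℝ, 0 < ρ ∧ ρ < 1 ∧ 0 < κ ∧ ∀ m j₀ : ℕ,
      ∃ t ∈ Icc (1 : ℝ) B, ∃ S : Finset (ℝ × ℝ), S.Nonempty ∧
      (∀ z ∈ S, z.1 ∈ X ∧ z.2 ∈ Y) ∧ ∃ p q : ℕ, j₀ ≤ p ∧ j₀ ≤ q ∧
      ∀ t', |t' - t| ≤ κ → ∀ i ≤ m, ∀ c : ℝ,
        ((S.filter fun z => |Int.fract ((r : ℝ) ^ p * z.1) +
          σ * t' * Int.fract ((s : ℝ) ^ q * z.2) - c| < ρ ^ i / 2).card : ℝ) ≤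
        (ρ ^ i) ^ γ * S.card := by
  obtain ⟨α, hα0, -, hαdim, hαle, hαge⟩ := hX.exists_exponent hr hXne
  obtain ⟨β, hβ0, hβ1, hβdim, hβle, hβge⟩ := hY.exists_exponent hs hYne
  have hr0 : 0 < r := by omega
  have hs0 : 0 < s := by omega
  have hlr : 0 < Real.log r := Real.log_pos (by exact_mod_cast hr)
  have hls : 0 < Real.log s := Real.log_pos (by exact_mod_cast hs)
  have hγαβ : γ < α + β := by
    have h1 : ENNReal.ofReal γ < ENNReal.ofReal (α + β) := by
      rw [ENNReal.ofReal_add hα0 hβ0]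
      exact (hγ.trans_le (min_le_left _ _)).trans_le (add_le_add hαdim hβdim)
    exact (ENNReal.ofReal_lt_ofReal_iff'.1 h1).1
  have hγ1 : γ < 1 := by
    have h1 := hγ.trans_le (min_le_right _ _)
    rw [← ENNReal.ofReal_one] at h1
    exact (ENNReal.ofReal_lt_ofReal_iff'.1 h1).1
  set γ₁ := min 1 (α + β) with hγ₁
  have hγγ₁ : γ < γ₁ := lt_min hγ1 hγαβ
  set γ' := (γ + γ₁) / 2 with hγ'
  have hη : 0 < γ₁ - γ' := by rw [hγ']; linarith
  obtain ⟨N₀, hN₀⟩ := exists_nat_gt (6 / (γ₁ - γ'))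
  set N := N₀ + 1 with hNdef
  have hN : (6 : ℝ) ≤ (γ₁ - γ') * N := by
    rw [div_lt_iff₀ hη] at hN₀
    rw [hNdef]
    push_cast
    nlinarith
  have hN0 : (0 : ℝ) < N := by rw [hNdef]; positivity
  -- With this ε all deficits together cost one log R, apart from a constant. The other losses are
  -- four times log R or log S ≤ log R, and the constants C take a sixth: hence the 6 in the choice
  -- of N.
  set ε : ℝ := 1 / (2 * ((N + 1) * N)) with hε
  have hε0 : 0 < ε := by positivity
  have hεN : 2 * ((N + 1) * (N * ε)) = 1 := by rw [hε]; field_simp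
  set C := Real.log 33 + Real.log 6 + Real.log (N + 1) + 6 * (N + 1) with hC
  have hmul : Tendsto (fun M : ℕ => s * M) atTop atTop :=
    tendsto_id.const_mul_atTop' hs0
  have hlogM : ∀ᶠ M : ℕ in atTop, C ≤ M * (s * Real.log r) :=
    (tendsto_natCast_atTop_atTop.atTop_mul_const (by positivity)).eventually_ge_atTop C
  obtain ⟨M, hM1, hM2, hM3, hM0⟩ := ((hmul.eventually (hαge ε hε0)).and
    ((hβge ε hε0).and (hlogM.and (eventually_gt_atTop 0)))).exists
  -- The extra exponent s gives S ≤ R, and M is large enough for one digit in the new bases to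
  -- realise α and β up to ε.
  set R := r ^ (s * M) with hR
  set S := s ^ M with hS
  have hR1 : 1 < R := Nat.one_lt_pow (by positivity) hr
  have hS1 : 1 < S := Nat.one_lt_pow hM0.ne' hs
  have hSR : S ≤ R := by
    rw [hS, hR, pow_mul]
    exact Nat.pow_le_pow_left (Nat.lt_pow_self hr).le M
  have hRR : (0 : ℝ) < R := by exact_mod_cast (by omega : 0 < R)
  have hSS : (0 : ℝ) < S := by exact_mod_cast (by omega : 0 < S)
  have hlogR : Real.log R = s * M * Real.log r := by
    rw [hR]; push_cast; rw [Real.log_pow]; push_cast; ring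
  have hlogS : Real.log S = M * Real.log s := by
    rw [hS]; push_cast; rw [Real.log_pow]
  have hlogSR : Real.log S ≤ Real.log R := Real.log_le_log hSS (by exact_mod_cast hSR)
  have hXR : IsFractInvariant R X := hX.pow _
  have hYS : IsFractInvariant S Y := hY.pow _
  have hsep := exists_direction_separated (N := N) hR1 hS1 hXR hYS hXne hYne hσ (α := α) (β := β)
    (γ := γ₁) (γ' := γ') (ε := ε) hβ0 hβ1 hε0.le (min_le_left _ _) (min_le_right _ _)
    (fun n => by
      have := hαle (s * M * n)
      rw [hR, cellFinset_pow, ← hR, hlogR]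
      refine le_trans (le_of_eq ?_) this
      push_cast
      ring)
    (fun n => by
      have := hβle (M * n)
      rw [hS, cellFinset_pow, ← hS, hlogS]
      refine le_trans (le_of_eq ?_) this
      push_cast
      ring)
    (by
      rw [hR, cellFinset_pow, ← hR, hlogR, mul_one]
      refine hM1.trans (le_of_eq ?_)
      push_cast
      ring)
    (by
      rw [hS, cellFinset_pow, ← hS, hlogS, mul_one]
      exact hM2)
    (by
      have h1 : Real.log (33 * S * R * (N + 1)) =
          Real.log 33 + Real.log S + Real.log R + Real.log (N + 1) := by
        rw [Real.log_mul (by positivity) (by positivity), Real.log_mul (by positivity)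
          (by positivity), Real.log_mul (by positivity) (by positivity)]
      have h2 : Real.log (2 * S + 4 : ℕ) ≤ Real.log 6 + Real.log S := by
        rw [← Real.log_mul (by norm_num) hSS.ne']
        refine Real.log_le_log (by positivity) ?_
        exact_mod_cast (by omega : 2 * S + 4 ≤ 6 * S)
      have h3 : 2 * ((N + 1) * (N * (ε * Real.log R) + 3)) = Real.log R + 6 * (N + 1) := by
        linear_combination Real.log R * hεN
      have h4 : C ≤ Real.log R := by rw [hlogR]; linarith
      have h5 : 0 ≤ Real.log R := Real.log_nonneg (by exact_mod_cast hR1.le)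
      have h6 := mul_le_mul_of_nonneg_right hN h5
      rw [h1, h3]
      linarith)
  have hρpos : (0 : ℝ) < ((R : ℝ) ^ N)⁻¹ := by positivity
  refine ⟨((R : ℝ) ^ N)⁻¹, ((R : ℝ) ^ N)⁻¹ / S, 2 * S, hρpos,
    inv_lt_one_of_one_lt₀ (one_lt_pow₀ (by exact_mod_cast hR1) (by omega)), by positivity,
    fun m j₀ => ?_⟩
  obtain ⟨t, ht, Z, hZne, hZ, p, q, hp, hq, h⟩ := exists_frostman_points hR1 hS1
    (by omega : 0 < N) hσ hγ0 (by rw [hγ']; linarith : γ < γ') hsep hX.subset_Ico hY.subset_Ico m j₀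
  refine ⟨t, ht, Z, hZne, hZ, s * M * p, M * q,
    hp.trans (Nat.le_mul_of_pos_left _ (by positivity)),
    hq.trans (Nat.le_mul_of_pos_left _ hM0), ?_⟩
  have e1 : (r : ℝ) ^ (s * M * p) = (R : ℝ) ^ p := by rw [hR]; push_cast; rw [pow_mul]
  have e2 : (s : ℝ) ^ (M * q) = (S : ℝ) ^ q := by rw [hS]; push_cast; rw [pow_mul]
  rw [e1, e2]
  exact h

/-- There is an open set of directions with uniformly Frostman projections. -/
theorem exists_frostman_direction {r s : ℕ} (hr : 1 < r) (hs : 1 < s) {X Y : Set ℝ}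
    (hX : IsFractInvariant r X) (hY : IsFractInvariant s Y) (hXne : X.Nonempty)
    (hYne : Y.Nonempty) {σ : ℝ} (hσ : |σ| = 1) {γ : ℝ} (hγ0 : 0 ≤ γ)
    (hγ : ENNReal.ofReal γ < min (dimH X + dimH Y) 1) :
    ∃ ρ t δ : ℝ, 0 < ρ ∧ ρ < 1 ∧ 0 < t ∧ 0 < δ ∧ ∀ t' ∈ ball t δ, ∀ m j₀ : ℕ,
      ∃ S : Finset (ℝ × ℝ), S.Nonempty ∧
      (∀ z ∈ S, z.1 ∈ X ∧ z.2 ∈ Y) ∧ ∃ p q : ℕ, j₀ ≤ p ∧ j₀ ≤ q ∧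
      ∀ i ≤ m, ∀ c : ℝ,
        ((S.filter fun z => |Int.fract ((r : ℝ) ^ p * z.1) +
          σ * t' * Int.fract ((s : ℝ) ^ q * z.2) - c| < ρ ^ i / 2).card : ℝ) ≤
        (ρ ^ i) ^ γ * S.card := by
  obtain ⟨ρ, κ, B, hρ0, hρ1, hκ, h⟩ := exists_frostman_scale hr hs hX hY hXne hYne hσ hγ0 hγ
  -- The tolerance κ does not depend on the depth. Hence directions within κ / 2 of a limit of the t
  -- i are admissible for arbitrarily large depths, which include all smaller ones.
  choose t ht S hSne hS p q hp hq hfr using fun i : ℕ => h i i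
  obtain ⟨t₀, ht₀, φ, hφ, hlim⟩ := isCompact_Icc.tendsto_subseq ht
  refine ⟨ρ, t₀, κ / 2, hρ0, hρ1, by linarith [ht₀.1], by positivity, fun t' ht' m j₀ => ?_⟩
  obtain ⟨k, hk1, hk2⟩ := ((hlim.eventually (ball_mem_nhds t₀ (half_pos hκ))).and
    (eventually_ge_atTop (max m j₀))).exists
  have hk : max m j₀ ≤ φ k := hk2.trans (hφ.id_le k)
  refine ⟨S (φ k), hSne _, hS _, p (φ k), q (φ k),
    ((le_max_right _ _).trans hk).trans (hp _), ((le_max_right _ _).trans hk).trans (hq _),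
    fun i hi c => hfr (φ k) t' ?_ i (hi.trans ((le_max_left _ _).trans hk)) c⟩
  rw [← Real.dist_eq]
  refine (dist_triangle_right _ _ t₀).trans ?_
  have h1 := mem_ball.1 ht'
  have h2 := mem_ball.1 hk1
  simp only [Function.comp_apply] at h2
  linarith

end Parameters

/-! ### From Frostman projections to lower bounds for covers. -/

section Content

/-- Rounding d up to the next power of ρ costs a factor ρ^(-γ); for d > 1 the bound is trivial. -/
theorem card_filter_le_of_pow_scale {α : Type*} {S : Finset α} {f : α → ℝ} {ρ γ : ℝ}
    (hρ0 : 0 < ρ) (hρ1 : ρ < 1) (hγ : 0 ≤ γ) {m : ℕ}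
    (h : ∀ i ≤ m, ∀ c : ℝ,
      ((S.filter fun z => |f z - c| < ρ ^ i / 2).card : ℝ) ≤ (ρ ^ i) ^ γ * S.card)
    {d : ℝ} (hd : ρ ^ m ≤ d) (c : ℝ) :
    ((S.filter fun z => |f z - c| < d / 2).card : ℝ) ≤ (d / ρ) ^ γ * S.card := by
  have hd0 : 0 < d := (pow_pos hρ0 m).trans_le hd
  have hdρ : d ≤ d / ρ := by rw [le_div_iff₀ hρ0]; nlinarith
  rcases le_or_gt d 1 with hd1 | hd1
  · obtain ⟨i, hi1, hi2⟩ := exists_nat_pow_near_of_lt_one hd0 hd1 hρ0 hρ1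
    have him : i ≤ m := by
      by_contra hcon
      push Not at hcon
      have := pow_lt_pow_right_of_lt_one₀ hρ0 hρ1 hcon
      linarith
    calc _ ≤ ((S.filter fun z => |f z - c| < ρ ^ i / 2).card : ℝ) := by
          refine Nat.cast_le.2 (Finset.card_le_card (Finset.monotone_filter_right _ ?_))
          intro z _ hz
          linarith
      _ ≤ (ρ ^ i) ^ γ * S.card := h i him c
      _ ≤ _ := by
          refine mul_le_mul_of_nonneg_right
            (Real.rpow_le_rpow (by positivity) ?_ hγ) (Nat.cast_nonneg _)
          rw [le_div_iff₀ hρ0, ← pow_succ]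
          exact hi1.le
  · calc _ ≤ (S.card : ℝ) := Nat.cast_le.2 (Finset.card_filter_le _ _)
      _ ≤ _ := le_mul_of_one_le_left (Nat.cast_nonneg _)
          (Real.one_le_rpow (by linarith) hγ)

/-- Covers of `X + σ T Y` are bounded below if `T rᵃ / sᵇ` is a Frostman direction. -/
theorem one_le_of_cover {r s : ℕ} (hr : 1 < r) (hs : 1 < s) {X Y : Set ℝ}
    (hX : IsFractInvariant r X) (hY : IsFractInvariant s Y) {σ ρ γ T : ℝ} (hρ0 : 0 < ρ)
    (hρ1 : ρ < 1) (hγ : 0 ≤ γ) {a b : ℕ}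
    (hfr : ∀ m j₀ : ℕ, ∃ S : Finset (ℝ × ℝ), S.Nonempty ∧
      (∀ z ∈ S, z.1 ∈ X ∧ z.2 ∈ Y) ∧ ∃ p q : ℕ, j₀ ≤ p ∧ j₀ ≤ q ∧
      ∀ i ≤ m, ∀ c : ℝ,
        ((S.filter fun z => |Int.fract ((r : ℝ) ^ p * z.1) +
          σ * (T * ((r : ℝ) ^ a / (s : ℝ) ^ b)) * Int.fract ((s : ℝ) ^ q * z.2) - c|
            < ρ ^ i / 2).card : ℝ) ≤ (ρ ^ i) ^ γ * S.card)
    {ι : Type*} (F : Finset ι) (c d : ι → ℝ) (hd : ∀ i ∈ F, 0 < d i)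
    (hcov : ∀ x ∈ X, ∀ y ∈ Y, ∃ i ∈ F, |x + σ * T * y - c i| < d i / 2) :
    1 ≤ (r : ℝ) ^ a * (s : ℝ) ^ b * ((r : ℝ) ^ a / ρ) ^ γ * ∑ i ∈ F, d i ^ γ := by
  classical
  have hr0 : 0 < r := by omega
  have hs0 : 0 < s := by omega
  have hrR : (0 : ℝ) < r := Nat.cast_pos.2 hr0
  have hsR : (0 : ℝ) < s := Nat.cast_pos.2 hs0
  set lam := (r : ℝ) ^ a with hlam
  have hlam1 : 1 ≤ lam := one_le_pow₀ (by exact_mod_cast hr.le)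
  set t := T * (lam / (s : ℝ) ^ b) with ht
  obtain ⟨m, hm⟩ : ∃ m : ℕ, ∀ i ∈ F, ρ ^ m ≤ d i := by
    have : ∀ᶠ m : ℕ in Filter.atTop, ∀ i ∈ F, ρ ^ m ≤ d i := by
      rw [Filter.eventually_all_finset]
      intro i hi
      exact ((tendsto_pow_atTop_nhds_zero_of_lt_one hρ0.le hρ1).eventually
        (gt_mem_nhds (hd i hi))).mono fun _ h => le_of_lt h
    exact this.exists
  -- Depth at least max a b leaves room to stop a and b digits early: the points of X and Y reached
  -- there are covered by hypothesis, and a and b further digits lead to the Frostman projection.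
  obtain ⟨S, hSne, hS, p, q, hp, hq, h⟩ := hfr m (max a b)
  obtain ⟨p', rfl⟩ := Nat.exists_eq_add_of_le' ((le_max_left a b).trans hp)
  obtain ⟨q', rfl⟩ := Nat.exists_eq_add_of_le' ((le_max_right a b).trans hq)
  set f : ℝ × ℝ → ℝ := fun z => Int.fract ((r : ℝ) ^ (p' + a) * z.1) +
    σ * t * Int.fract ((s : ℝ) ^ (q' + b) * z.2) with hf
  set IA := Finset.Ico (0 : ℤ) ((r : ℤ) ^ a) with hIA
  set IB := Finset.Ico (0 : ℤ) ((s : ℤ) ^ b) with hIB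
  -- Those last digits translate the projection, scaled by r^a, in one of r^a s^b ways. Each
  -- interval of the cover thus yields r^a s^b intervals of r^a times its length.
  set G : ι × ℤ × ℤ → Finset (ℝ × ℝ) := fun e => S.filter fun z =>
    |f z - (lam * c e.1 - e.2.1 - σ * t * e.2.2)| < lam * d e.1 / 2 with hG
  have hsub : S ⊆ (F ×ˢ IA ×ˢ IB).biUnion G := by
    intro z hz
    obtain ⟨hzX, hzY⟩ := hS z hz
    have hx := hX.fract_pow_mem p' hzX
    have hy := hY.fract_pow_mem q' hzY
    set x := Int.fract ((r : ℝ) ^ p' * z.1) with hxdef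
    set y := Int.fract ((s : ℝ) ^ q' * z.2) with hydef
    obtain ⟨i, hi, hxy⟩ := hcov x hx y hy
    refine Finset.mem_biUnion.2 ⟨(i, digitCell r a x, digitCell s b y), ?_, ?_⟩
    · exact Finset.mem_product.2 ⟨hi, Finset.mem_product.2
        ⟨digitCell_mem_Ico hr0 a (hX.subset_Ico hx), digitCell_mem_Ico hs0 b (hY.subset_Ico hy)⟩⟩
    refine Finset.mem_filter.2 ⟨hz, ?_⟩
    have e1 : f z = (lam * x - digitCell r a x) + σ * t * ((s : ℝ) ^ b * y - digitCell s b y) := by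
      simp only [hf]
      rw [fract_pow_add, fract_pow_add, ← hxdef, ← hydef]
      rfl
    have e2 : t * (s : ℝ) ^ b = T * lam := by rw [ht]; field_simp
    have e3 : f z - (lam * c i - digitCell r a x - σ * t * digitCell s b y) =
        lam * (x + σ * T * y - c i) := by
      rw [e1]
      linear_combination σ * y * e2
    simp only
    rw [e3, abs_mul, abs_of_pos (by linarith : 0 < lam), mul_div_assoc]
    exact mul_lt_mul_of_pos_left hxy (by linarith)
  have hSpos : (0 : ℝ) < S.card := Nat.cast_pos.2 (Finset.card_pos.2 hSne)
  have hcard : (S.card : ℝ) ≤ ∑ e ∈ F ×ˢ IA ×ˢ IB, (lam * d e.1 / ρ) ^ γ * S.card := by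
    have h1 : (S.card : ℝ) ≤ ∑ e ∈ F ×ˢ IA ×ˢ IB, ((G e).card : ℝ) := by
      exact_mod_cast (Finset.card_le_card hsub).trans Finset.card_biUnion_le
    refine h1.trans (Finset.sum_le_sum fun e he => ?_)
    have hi := (Finset.mem_product.1 he).1
    refine card_filter_le_of_pow_scale hρ0 hρ1 hγ h ((hm _ hi).trans ?_) _
    exact le_mul_of_one_le_left (hd _ hi).le hlam1
  rw [← Finset.sum_mul] at hcard
  have h2 : 1 ≤ ∑ e ∈ F ×ˢ IA ×ˢ IB, (lam * d e.1 / ρ) ^ γ := by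
    by_contra hcon
    push Not at hcon
    nlinarith
  refine h2.trans (le_of_eq ?_)
  rw [Finset.sum_product]
  simp only [Finset.sum_const, nsmul_eq_mul]
  have hcA : ((IA ×ˢ IB).card : ℝ) = (r : ℝ) ^ a * (s : ℝ) ^ b := by
    have e1 : ((r : ℤ) ^ a).toNat = r ^ a := by exact_mod_cast Int.toNat_natCast (r ^ a)
    have e2 : ((s : ℤ) ^ b).toNat = s ^ b := by exact_mod_cast Int.toNat_natCast (s ^ b)
    rw [Finset.card_product, hIA, hIB, Int.card_Ico, Int.card_Ico, sub_zero, sub_zero, e1, e2]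
    push_cast
    ring
  rw [hcA, ← Finset.mul_sum, mul_assoc (lam * (s : ℝ) ^ b)]
  congr 1
  rw [Finset.mul_sum]
  refine Finset.sum_congr rfl fun i hi => ?_
  rw [← Real.mul_rpow (by positivity) (hd i hi).le]
  congr 1
  ring

/-- Uniform lower bound of the sizes of covers of `X + σ T Y` for `T` in a compact set. -/
theorem exists_cover_sum_ge {r s : ℕ} (hr : 1 < r) (hs : 1 < s)
    (hrs : Irrational (Real.log r / Real.log s)) {X Y : Set ℝ}
    (hX : IsFractInvariant r X) (hY : IsFractInvariant s Y) (hXne : X.Nonempty)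
    (hYne : Y.Nonempty) {σ : ℝ} (hσ : |σ| = 1) {γ : ℝ} (hγ0 : 0 ≤ γ)
    (hγ : ENNReal.ofReal γ < min (dimH X + dimH Y) 1) {K : Set ℝ} (hK : IsCompact K)
    (hKpos : ∀ T ∈ K, 0 < T) :
    ∃ C > 0, ∀ T ∈ K, ∀ (ι : Type) (F : Finset ι) (c d : ι → ℝ), (∀ i ∈ F, 0 < d i) →
      (∀ x ∈ X, ∀ y ∈ Y, ∃ i ∈ F, |x + σ * T * y - c i| < d i / 2) →
      C ≤ ∑ i ∈ F, d i ^ γ := by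
  obtain ⟨ρ, t, δ, hρ0, hρ1, ht, hδ, hfr⟩ :=
    exists_frostman_direction hr hs hX hY hXne hYne hσ hγ0 hγ
  -- Near a fixed T the same exponents a, b keep the slope in the good interval, so the constant is
  -- locally uniform.
  refine hK.induction_on (p := fun K => ∃ C > 0, ∀ T ∈ K, ∀ (ι : Type) (F : Finset ι)
      (c d : ι → ℝ), (∀ i ∈ F, 0 < d i) →
      (∀ x ∈ X, ∀ y ∈ Y, ∃ i ∈ F, |x + σ * T * y - c i| < d i / 2) →
      C ≤ ∑ i ∈ F, d i ^ γ) ⟨1, one_pos, by simp⟩ ?_ ?_ ?_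
  · rintro K₁ K₂ h ⟨C, hC, h2⟩
    exact ⟨C, hC, fun T hT => h2 T (h hT)⟩
  · rintro K₁ K₂ ⟨C₁, hC₁, h₁⟩ ⟨C₂, hC₂, h₂⟩
    refine ⟨min C₁ C₂, lt_min hC₁ hC₂, fun T hT ι F c d hd hcov => ?_⟩
    rcases hT with hT | hT
    · exact (min_le_left _ _).trans (h₁ T hT ι F c d hd hcov)
    · exact (min_le_right _ _).trans (h₂ T hT ι F c d hd hcov)
  · intro T hT
    obtain ⟨a, b, hab⟩ := exists_mul_pow_div_pow_mem hr hs hrs (hKpos T hT) ht hδ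
    have hopen : IsOpen {T' : ℝ | T' * ((r : ℝ) ^ a / (s : ℝ) ^ b) ∈ ball t δ} :=
      isOpen_ball.preimage (by fun_prop)
    refine ⟨_, mem_nhdsWithin_of_mem_nhds (hopen.mem_nhds hab), ?_⟩
    have hrR : (0 : ℝ) < r := by exact_mod_cast (by omega : 0 < r)
    have hsR : (0 : ℝ) < s := by exact_mod_cast (by omega : 0 < s)
    set D := (r : ℝ) ^ a * (s : ℝ) ^ b * ((r : ℝ) ^ a / ρ) ^ γ with hD
    have hD0 : 0 < D := by positivity
    refine ⟨D⁻¹, inv_pos.2 hD0, fun T' hT' ι F c d hd hcov => ?_⟩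
    rw [inv_le_iff_one_le_mul₀' hD0]
    exact one_le_of_cover hr hs hX hY hρ0 hρ1 hγ0 (hfr _ hT') F c d hd hcov

end Content

/-! ### Projections in the plane and the reduction to X + τY. -/

section Plane

theorem IsTimesInvariant.isFractInvariant_inter {r : ℕ} {X : Set ℝ} (hX : IsTimesInvariant r X) :
    IsFractInvariant r (X ∩ Ico 0 1) :=
  ⟨inter_subset_right, fun x hx =>
    ⟨hX.image_subset ⟨x, hx.1, rfl⟩, Int.fract_nonneg _, Int.fract_lt_one _⟩⟩

theorem IsTimesInvariant.inter_nonempty {r : ℕ} {X : Set ℝ} (hX : IsTimesInvariant r X)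
    (hne : X.Nonempty) : (X ∩ Ico 0 1).Nonempty := by
  obtain ⟨x, hx⟩ := hne
  exact ⟨_, hX.image_subset ⟨x, hx, rfl⟩, Int.fract_nonneg _, Int.fract_lt_one _⟩

/-- Only the point 1 is discarded. -/
theorem IsTimesInvariant.dimH_le {r : ℕ} {X : Set ℝ} (hX : IsTimesInvariant r X) :
    dimH X ≤ dimH (X ∩ Ico 0 1) := by
  have h : X ⊆ (X ∩ Ico 0 1) ∪ {1} := fun x hx => by
    obtain ⟨h0, h1⟩ := hX.subset_unitInterval hx
    rcases h1.lt_or_eq with h | h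
    · exact Or.inl ⟨hx, h0, h⟩
    · exact Or.inr h
  refine (dimH_mono h).trans ?_
  rw [dimH_union, dimH_singleton]
  simp

theorem norm_angle_vector (θ : ℝ) :
    ‖(!₂[Real.cos θ, Real.sin θ] : EuclideanSpace ℝ (Fin 2))‖ = 1 := by
  rw [EuclideanSpace.norm_eq, Fin.sum_univ_two]
  simp

theorem inner_angleProj (θ : ℝ) (p : EuclideanSpace ℝ (Fin 2)) :
    inner ℝ (!₂[Real.cos θ, Real.sin θ] : EuclideanSpace ℝ (Fin 2)) (angleProj θ p) =
      Real.cos θ * p 0 + Real.sin θ * p 1 := by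
  have h : angleProj θ p = inner ℝ (!₂[Real.cos θ, Real.sin θ] : EuclideanSpace ℝ (Fin 2)) p •
      (!₂[Real.cos θ, Real.sin θ] : EuclideanSpace ℝ (Fin 2)) :=
    Submodule.starProjection_unit_singleton ℝ (norm_angle_vector θ) p
  rw [h, inner_smul_right, real_inner_self_eq_norm_sq, norm_angle_vector]
  simp [PiLp.inner_apply, Fin.sum_univ_two, mul_comm]

theorem isCompact_planeProd {X Y : Set ℝ} (hX : IsCompact X) (hY : IsCompact Y) :
    IsCompact (planeProd X Y) := by
  have h : planeProd X Y = (fun z : ℝ × ℝ => (!₂[z.1, z.2] : EuclideanSpace ℝ (Fin 2))) ''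
      (X ×ˢ Y) := by
    ext p
    constructor
    · intro hp
      refine ⟨(p 0, p 1), hp, ?_⟩
      ext i
      fin_cases i <;> rfl
    · rintro ⟨z, hz, rfl⟩
      exact hz
  rw [h]
  exact (hX.prod hY).image (by fun_prop)

/-- A lower bound for covers of `X + σ T Y` by intervals bounds the content of the corresponding
projection of `X × Y`. -/
theorem ofReal_mul_le_hausdorffContent {X Y : Set ℝ} (hX : IsCompact X) (hY : IsCompact Y)
    {X₀ Y₀ : Set ℝ} (hX₀ : X₀ ⊆ X) (hY₀ : Y₀ ⊆ Y) {γ C κ θ τ : ℝ} (hγ : 0 ≤ γ)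
    (hκ : 0 < κ) (hκθ : κ ≤ |Real.cos θ|) (hτ : τ * Real.cos θ = Real.sin θ)
    (h : ∀ (ι : Type) (F : Finset ι) (c d : ι → ℝ), (∀ i ∈ F, 0 < d i) →
      (∀ x ∈ X₀, ∀ y ∈ Y₀, ∃ i ∈ F, |x + τ * y - c i| < d i / 2) → C ≤ ∑ i ∈ F, d i ^ γ) :
    ENNReal.ofReal (C * κ ^ γ) ≤ hausdorffContent γ (angleProj θ '' planeProd X Y) := by
  refine le_sInf ?_
  rintro _ ⟨ι, _, c, δ, hδ, hcov, rfl⟩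
  have hcomp : IsCompact (angleProj θ '' planeProd X Y) :=
    (isCompact_planeProd hX hY).image ((angleLine θ).starProjection.continuous)
  -- The projection is compact and the balls are open, so finite covers suffice. This is where
  -- closedness of X and Y matters.
  obtain ⟨F, hF⟩ := hcomp.elim_finite_subcover _ (fun i => isOpen_ball) hcov
  set a := Real.cos θ with ha
  have ha0 : 0 < |a| := hκ.trans_le hκθ
  have ha' : a ≠ 0 := abs_pos.1 ha0
  set u : EuclideanSpace ℝ (Fin 2) := !₂[Real.cos θ, Real.sin θ] with hu
  -- The coordinate along the line is cos θ (x + τy), so a ball becomes an interval of length δ /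
  -- |cos θ|.
  have key := h ι F (fun i => inner ℝ u (c i) / a) (fun i => δ i / |a|)
    (fun i _ => div_pos (hδ i) ha0) (fun x hx y hy => by
      have hp : angleProj θ (!₂[x, y]) ∈ angleProj θ '' planeProd X Y :=
        ⟨_, ⟨hX₀ hx, hY₀ hy⟩, rfl⟩
      obtain ⟨i, hi⟩ := mem_iUnion.1 (hF hp)
      obtain ⟨hiF, hi⟩ := mem_iUnion.1 hi
      refine ⟨i, hiF, ?_⟩
      have h1 : |inner ℝ u (angleProj θ (!₂[x, y])) - inner ℝ u (c i)| < δ i / 2 := by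
        rw [← inner_sub_right]
        refine (abs_real_inner_le_norm _ _).trans_lt ?_
        rw [hu, norm_angle_vector, one_mul, ← dist_eq_norm]
        exact mem_ball.1 hi
      rw [hu, inner_angleProj, ← hu, ← ha] at h1
      have h2 : x + τ * y - inner ℝ u (c i) / a =
          (a * x + Real.sin θ * y - inner ℝ u (c i)) / a := by
        rw [← hτ]; field_simp
      rw [h2, abs_div, div_lt_iff₀ ha0]
      refine h1.trans_eq ?_
      field_simp)
  have h3 : C * κ ^ γ ≤ ∑ i ∈ F, δ i ^ γ := by
    have h4 : ∀ i ∈ F, (δ i / |a|) ^ γ * κ ^ γ ≤ δ i ^ γ := by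
      intro i _
      have := hδ i
      rw [← Real.mul_rpow (by positivity) hκ.le]
      refine Real.rpow_le_rpow (by positivity) ?_ hγ
      rw [div_mul_eq_mul_div, div_le_iff₀ ha0]
      exact mul_le_mul_of_nonneg_left hκθ this.le
    calc C * κ ^ γ ≤ (∑ i ∈ F, (δ i / |a|) ^ γ) * κ ^ γ :=
          mul_le_mul_of_nonneg_right key (by positivity)
      _ = ∑ i ∈ F, (δ i / |a|) ^ γ * κ ^ γ := Finset.sum_mul _ _ _
      _ ≤ _ := Finset.sum_le_sum h4
  calc ENNReal.ofReal (C * κ ^ γ) ≤ ENNReal.ofReal (∑ i ∈ F, δ i ^ γ) :=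
        ENNReal.ofReal_le_ofReal h3
    _ = ∑ i ∈ F, ENNReal.ofReal (δ i ^ γ) :=
        ENNReal.ofReal_sum_of_nonneg fun i _ => Real.rpow_nonneg (hδ i).le _
    _ ≤ _ := ENNReal.sum_le_tsum F

theorem MultIndep.one_lt {r s : ℕ} (h : MultIndep r s) : 1 < r ∧ 1 < s := by
  obtain ⟨hr, hs, hirr⟩ := h
  constructor
  · by_contra hcon
    have : r = 1 := by omega
    subst this
    simp at hirr
  · by_contra hcon
    have : s = 1 := by omega
    subst this
    simp at hirr

end Plane

theorem theoremB (r s : ℕ) (hrs : MultIndep r s) (X Y : Set ℝ)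
    (hX : IsTimesInvariant r X) (hY : IsTimesInvariant s Y)
    (hXne : X.Nonempty) (hYne : Y.Nonempty)
    (I : Set ℝ) (hI : IsCompact I) (hIsub : I ⊆ Set.Ioo 0 Real.pi \ {Real.pi / 2})
    (γ : ℝ) (hγ0 : 0 ≤ γ) (hγ : ENNReal.ofReal γ < min (dimH X + dimH Y) 1) :
    0 < ⨅ θ ∈ I, hausdorffContent γ (angleProj θ '' planeProd X Y) := by
  obtain ⟨hr, hs⟩ := hrs.one_lt
  have hcX : IsCompact X := isCompact_Icc.of_isClosed_subset hX.isClosed hX.subset_unitInterval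
  have hcY : IsCompact Y := isCompact_Icc.of_isClosed_subset hY.isClosed hY.subset_unitInterval
  have hγ' : ENNReal.ofReal γ < min (dimH (X ∩ Ico 0 1) + dimH (Y ∩ Ico 0 1)) 1 :=
    hγ.trans_le (min_le_min (add_le_add hX.dimH_le hY.dimH_le) le_rfl)
  have hcos : ∀ θ ∈ I, Real.cos θ ≠ 0 := by
    intro θ hθ h0
    obtain ⟨⟨h1, h2⟩, h3⟩ := hIsub hθ
    exact h3 (Real.injOn_cos ⟨h1.le, h2.le⟩ ⟨by positivity, by linarith [Real.pi_pos]⟩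
      (by rw [h0, Real.cos_pi_div_two]))
  have hsin : ∀ θ ∈ I, 0 < Real.sin θ := fun θ hθ =>
    Real.sin_pos_of_pos_of_lt_pi (hIsub hθ).1.1 (hIsub hθ).1.2
  obtain ⟨κ, hκ, hκI⟩ : ∃ κ > 0, ∀ θ ∈ I, κ ≤ |Real.cos θ| := by
    rcases I.eq_empty_or_nonempty with rfl | hIne
    · exact ⟨1, one_pos, by simp⟩
    obtain ⟨θ₀, hθ₀, hmin⟩ := hI.exists_isMinOn hIne
      (Real.continuous_cos.abs.continuousOn (s := I))
    exact ⟨_, abs_pos.2 (hcos θ₀ hθ₀), fun θ hθ => hmin hθ⟩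
  -- Avoiding 0, π / 2 and π keeps |tan θ| in a compact subset of (0, ∞). Its sign is treated
  -- separately, by σ = 1 and σ = -1, since multiplying by r^a / s^b preserves it.
  set K : Set ℝ := (fun θ => |Real.tan θ|) '' I with hK
  have hKc : IsCompact K := by
    refine hI.image_of_continuousOn (ContinuousOn.abs fun θ hθ => ?_)
    exact (Real.continuousAt_tan.2 (hcos θ hθ)).continuousWithinAt
  have hKpos : ∀ T ∈ K, 0 < T := by
    rintro _ ⟨θ, hθ, rfl⟩
    refine abs_pos.2 ?_
    rw [Real.tan_eq_sin_div_cos]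
    exact div_ne_zero (hsin θ hθ).ne' (hcos θ hθ)
  obtain ⟨C₁, hC₁, h₁⟩ := exists_cover_sum_ge hr hs hrs.2.2 hX.isFractInvariant_inter
    hY.isFractInvariant_inter (hX.inter_nonempty hXne) (hY.inter_nonempty hYne)
    (σ := 1) (by simp) hγ0 hγ' hKc hKpos
  obtain ⟨C₂, hC₂, h₂⟩ := exists_cover_sum_ge hr hs hrs.2.2 hX.isFractInvariant_inter
    hY.isFractInvariant_inter (hX.inter_nonempty hXne) (hY.inter_nonempty hYne)
    (σ := -1) (by simp) hγ0 hγ' hKc hKpos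
  have hC : 0 < min C₁ C₂ := lt_min hC₁ hC₂
  refine lt_of_lt_of_le (ENNReal.ofReal_pos.2 (mul_pos hC (Real.rpow_pos_of_pos hκ γ)))
    (le_iInf₂ fun θ hθ => ?_)
  refine ofReal_mul_le_hausdorffContent hcX hcY inter_subset_left inter_subset_left
    (X₀ := X ∩ Ico 0 1) (Y₀ := Y ∩ Ico 0 1) (τ := Real.tan θ) hγ0 hκ (hκI θ hθ) (Real.tan_mul_cos (hcos θ hθ))
    fun ι F c d hd hcov => ?_
  rcases abs_choice (Real.tan θ) with habs | habs
  · refine (min_le_left _ _).trans (h₁ _ ⟨θ, hθ, rfl⟩ ι F c d hd fun x hx y hy => ?_)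
    simp only [habs, one_mul]
    exact hcov x hx y hy
  · refine (min_le_right _ _).trans (h₂ _ ⟨θ, hθ, rfl⟩ ι F c d hd fun x hx y hy => ?_)
    simp only [habs, neg_mul_neg, one_mul]
    exact hcov x hx y hy
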